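/- Let $n\ge 1$, let $0<\alpha\le 1$, and let all functions $f,\varphi$ below take values in a fixed scalar field $\mathbb{K}\in\{\mathbb{R},\mathbb{C}\}$. Let $\mathcal{C}_\alpha$ be the family of functions $\varphi$ on $\mathbb{R}^n$ that vanish outside $\{|x|\le 1\}$ and satisfy $\int_{\mathbb{R}^n}\varphi\,dx=0$ and $|\varphi(x)-\varphi(x')|\le |x-x'|^\alpha$ for all $x,x'\in\mathbb{R}^n$. Put $\varphi_t(x)=t^{-n}\varphi(x/t)$ for $t>0$. For a locally integrable function $f$ on $\mathbb{R}^n$ define $$A_\alpha(f)(y,t)=\sup_{\varphi\in\mathcal{C}_\alpha}\left|\int_{\mathbb{R}^n}\varphi_t(y-z)f(z)\,dz\right|,\qquad g_\alpha(f)(x)=\left(\int_0^\infty A_\alpha(f)(x,t)^2\,\frac{dt}{t}\right)^{1/2}\in[0,\infty].$$ Let $\Phi$ be a positive, increasing (that is, non-decreasing) function on $(0,\infty)$ for which there is a constant $D=D(\Phi)\ge 1$ with $\Phi(2r)\le D\,\Phi(r)$ for all $r>0$. Write $B(x_0,r)$ for the open ball with center $x_0\in\mathbb{R}^n$ and radius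 $r>0$, and $|E|$ for the Lebesgue measure of $E$. The space $L^{1,\Phi}$ consists of the locally integrable $f$ whose norm $\|f\|_{L^{1,\Phi}}$ is finite, where $\|f\|_{L^{1,\Phi}}$ is the smallest $C\in[0,\infty]$ such that $\int_{B(x_0,r)}|f|\,dx\le C\,\Phi(r)$ for all $x_0\in\mathbb{R}^n$ and $r>0$. The space $WL^{1,\Phi}$ consists of the measurable, almost everywhere finite $h$ with $\|h\|_{WL^{1,\Phi}}<\infty$, where $\|h\|_{WL^{1,\Phi}}$ is the smallest $C\in[0,\infty]$ such that $\sup_{\lambda>0}\lambda\,|\{x\in B(x_0,r):|h(x)|>\lambda\}|\le C\,\Phi(r)$ for all $x_0\in\mathbb{R}^n$ and $r>0$. **Corollary 1.8.** If $D(\Phi)<2^n$, then $g_\alpha$ maps $L^{1,\Phi}$ into $WL^{1,\Phi}$, and there is a constant $C>0$, independent of $f$, such that $$\|g_\alpha(f)\|_{WL^{1,\Phi}}\le C\,\|f\|_{L^{1,\Phi}}\qquad\text{for all } f\in L^{1,\Phi}.$$ -/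

import Mathlib

open MeasureTheory Set
open scoped ENNReal NNReal

noncomputable section

namespace IntrinsicSquare

/-- A growth function: positive and increasing (non-decreasing) on `(0, ∞)`, and doubling with
constant `D ≥ 1`. Only the values of `Φ` on `(0, ∞)` matter. -/
structure IsGrowthFunction (Φ : ℝ → ℝ) (D : ℝ) : Prop where
  pos : ∀ r : ℝ, 0 < r → 0 < Φ r
  mono : MonotoneOn Φ (Ioi 0)
  one_le : 1 ≤ D
  doubling : ∀ r : ℝ, 0 < r → Φ (2 * r) ≤ D * Φ r

/-- The Morrey norm of `L^{1,Φ}`: the smallest `C ∈ [0, ∞]` with `∫_{B(x₀,r)} |f| ≤ C Φ(r)` for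
every ball. -/
def morreyNorm {n : ℕ} {𝕜 : Type*} [RCLike 𝕜] (Φ : ℝ → ℝ)
    (f : EuclideanSpace ℝ (Fin n) → 𝕜) : ℝ≥0∞ :=
  sInf {C : ℝ≥0∞ | ∀ (x₀ : EuclideanSpace ℝ (Fin n)) (r : ℝ), 0 < r →
    ∫⁻ x in Metric.ball x₀ r, ‖f x‖ₑ ≤ C * ENNReal.ofReal (Φ r)}

/-- Membership in the generalized Morrey space `L^{1,Φ}(ℝⁿ)`. -/
structure MemMorrey {n : ℕ} {𝕜 : Type*} [RCLike 𝕜] (Φ : ℝ → ℝ)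
    (f : EuclideanSpace ℝ (Fin n) → 𝕜) : Prop where
  locallyIntegrable : LocallyIntegrable f volume
  norm_lt_top : morreyNorm Φ f < ∞

/-- The norm of `WL^{1,Φ}`, for a non-negative extended-valued `h`: the smallest `C ∈ [0, ∞]`
with `sup_{s > 0} s |{x ∈ B(x₀,r) : h(x) > s}| ≤ C Φ(r)` for every ball. -/
def weakMorreyNorm {n : ℕ} (Φ : ℝ → ℝ) (h : EuclideanSpace ℝ (Fin n) → ℝ≥0∞) : ℝ≥0∞ :=
  sInf {C : ℝ≥0∞ | ∀ (x₀ : EuclideanSpace ℝ (Fin n)) (r : ℝ), 0 < r →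
    ⨆ (s : ℝ) (_ : 0 < s),
      ENNReal.ofReal s * volume {x | x ∈ Metric.ball x₀ r ∧ ENNReal.ofReal s < h x}
    ≤ C * ENNReal.ofReal (Φ r)}

/-- Membership of a non-negative function in the generalized weak Morrey space `WL^{1,Φ}(ℝⁿ)`. -/
structure MemWeakMorrey {n : ℕ} (Φ : ℝ → ℝ) (h : EuclideanSpace ℝ (Fin n) → ℝ≥0∞) : Prop where
  measurable : Measurable h
  ae_lt_top : ∀ᵐ x, h x < ∞
  norm_lt_top : weakMorreyNorm Φ h < ∞

/-- The family `𝒞_α` of test kernels. -/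
structure IsKernel {n : ℕ} {𝕜 : Type*} [RCLike 𝕜] (α : ℝ)
    (φ : EuclideanSpace ℝ (Fin n) → 𝕜) : Prop where
  support_subset : Function.support φ ⊆ Metric.closedBall 0 1
  integral_eq_zero : ∫ x, φ x = 0
  holder : ∀ x x' : EuclideanSpace ℝ (Fin n), ‖φ x - φ x'‖ ≤ ‖x - x'‖ ^ α

/-- The dilation `φ_t(x) = t⁻ⁿ φ(x / t)`. -/
def dilate {n : ℕ} {𝕜 : Type*} [RCLike 𝕜] (t : ℝ) (φ : EuclideanSpace ℝ (Fin n) → 𝕜)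
    (x : EuclideanSpace ℝ (Fin n)) : 𝕜 :=
  (t ^ n)⁻¹ • φ (t⁻¹ • x)

/-- `A_α(f)(y,t) = sup_{φ ∈ 𝒞_α} |(f * φ_t)(y)|`. -/
def intrinsicA {n : ℕ} {𝕜 : Type*} [RCLike 𝕜] (α : ℝ) (f : EuclideanSpace ℝ (Fin n) → 𝕜)
    (y : EuclideanSpace ℝ (Fin n)) (t : ℝ) : ℝ≥0∞ :=
  ⨆ (φ : EuclideanSpace ℝ (Fin n) → 𝕜) (_ : IsKernel α φ),
    ‖∫ z, dilate t φ (y - z) * f z‖ₑ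

/-- The intrinsic Littlewood–Paley `g`-function
`g_α(f)(x) = (∫₀^∞ A_α(f)(x,t)² dt/t)^{1/2}`, with values in `[0, ∞]`. -/
def intrinsicG {n : ℕ} {𝕜 : Type*} [RCLike 𝕜] (α : ℝ) (f : EuclideanSpace ℝ (Fin n) → 𝕜)
    (x : EuclideanSpace ℝ (Fin n)) : ℝ≥0∞ :=
  (∫⁻ t in Ioi (0 : ℝ), intrinsicA α f x t ^ 2 / ENNReal.ofReal t) ^ (1 / 2 : ℝ)

end IntrinsicSquare

end

/-! The square of `intrinsicG` is compared with `discreteG`, a sum over dyadic scales of squared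
suprema over bumps. Everything then rests on a weak type (1,1) bound for `discreteG` and on a
pointwise bound for distant mass.

On `L²`, a near-optimal bump is chosen in each dyadic cube, which removes the suprema. Two bumps at
scales `2 ^ j` and `2 ^ k` are almost orthogonal: the mean zero of the smaller, against the Hölder
continuity of the larger, gains `2 ^ (-α |j - k|)`. The Boas–Bellman inequality
`sum_mul_norm_inner_sq_le`, with cube volumes as weights, turns this into `lintegral_discreteG_le`.

For `mul_volume_discreteG_le`, a Calderón–Zygmund decomposition gives a bounded good part, treated
in `L²`, and a bad part with mean zero on disjoint cubes. Away from enlarged cubes the bad part is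
summed in `L¹`, since cancellation on a cube of side `2 ^ i` gains `2 ^ (-α (k - i))` at scale `2 ^
k`.

In the Morrey space, `f` is cut at the doubled ball. The inner part obeys the weak type bound. A
bump centred in the ball reaches the outer part only at scales comparable to `2 ^ i r` with `i ≥ 0`,
where it contributes at most a multiple of `r⁻ⁿ Φ(r) (D / 2 ^ n) ^ i`; the condition `D < 2 ^ n`
makes this series converge (`discreteG_indicator_compl_le`).

The functions `bumpSup` and `discreteG` are never shown measurable: Chebyshev's inequality is
applied to measurable majorants. Measurability of `intrinsicG` itself comes from lower
semicontinuity. -/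

noncomputable section

namespace IntrinsicSquare

variable {n : ℕ} {𝕜 : Type*} [RCLike 𝕜] {α : ℝ}

/-! ### Dyadic cubes -/

/-- The multi-index of the dyadic cube of side `2 ^ k` which contains `x`. -/
def cubeIndex (k : ℤ) (x : EuclideanSpace ℝ (Fin n)) : Fin n → ℤ := fun i => ⌊x i / 2 ^ k⌋

/-- The dyadic cube of side `2 ^ k` with multi-index `m`. -/
def cube (k : ℤ) (m : Fin n → ℤ) : Set (EuclideanSpace ℝ (Fin n)) := {x | cubeIndex k x = m}

@[simp] lemma mem_cube {k : ℤ} {m : Fin n → ℤ} {x : EuclideanSpace ℝ (Fin n)} :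
    x ∈ cube k m ↔ cubeIndex k x = m := Iff.rfl

lemma measurable_cubeIndex (k : ℤ) : Measurable (cubeIndex (n := n) k) := by
  refine measurable_pi_iff.2 fun i => Int.measurable_floor.comp ?_
  fun_prop

lemma measurableSet_cube (k : ℤ) (m : Fin n → ℤ) : MeasurableSet (cube k m) :=
  measurable_cubeIndex k (measurableSet_singleton m)

lemma disjoint_cube {k : ℤ} {m m' : Fin n → ℤ} (h : m ≠ m') : Disjoint (cube k m) (cube k m') :=
  Set.disjoint_left.2 fun _ hx hx' => h (hx.symm.trans hx')

lemma cubeIndex_succ (k : ℤ) (x : EuclideanSpace ℝ (Fin n)) :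
    cubeIndex (k + 1) x = fun i => cubeIndex k x i / 2 := by
  funext i
  have := Int.floor_div_natCast (x i / 2 ^ k) 2
  simp only [cubeIndex]
  rw [zpow_add_one₀ two_ne_zero, ← div_div]
  exact_mod_cast this

lemma cubeIndex_eq_of_le {k j : ℤ} (hkj : k ≤ j) {x y : EuclideanSpace ℝ (Fin n)}
    (h : cubeIndex k x = cubeIndex k y) : cubeIndex j x = cubeIndex j y := by
  induction j, hkj using Int.leInduction with
  | base => exact h
  | succ j _ ih => rw [cubeIndex_succ, cubeIndex_succ, ih]

lemma mem_cube_iff_Ico {k : ℤ} {m : Fin n → ℤ} {x : EuclideanSpace ℝ (Fin n)} :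
    x ∈ cube k m ↔ ∀ i, x i ∈ Ico ((2 : ℝ) ^ k * m i) (2 ^ k * m i + 2 ^ k) := by
  have h2 : (0 : ℝ) < 2 ^ k := by positivity
  simp only [mem_cube, cubeIndex, funext_iff, Int.floor_eq_iff, mem_Ico]
  refine forall_congr' fun i => ?_
  rw [le_div_iff₀ h2, div_lt_iff₀ h2]
  constructor <;> rintro ⟨h, h'⟩ <;> constructor <;> linarith

lemma volume_cube (k : ℤ) (m : Fin n → ℤ) :
    volume (cube k m) = ENNReal.ofReal (((2 : ℝ) ^ k) ^ n) := by
  have : cube k m = (WithLp.ofLp : EuclideanSpace ℝ (Fin n) → Fin n → ℝ) ⁻¹'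
      (Set.univ.pi fun i => Ico ((2 : ℝ) ^ k * m i) (2 ^ k * m i + 2 ^ k)) := by
    ext x
    rw [mem_cube_iff_Ico]
    simp
  rw [this, (PiLp.volume_preserving_ofLp (Fin n)).measure_preimage
    (MeasurableSet.univ_pi fun i => measurableSet_Ico).nullMeasurableSet, Real.volume_pi_Ico]
  simp only [add_sub_cancel_left, Finset.prod_const, Finset.card_univ, Fintype.card_fin]
  rw [ENNReal.ofReal_pow (by positivity)]

/-- The lower corner of a dyadic cube. -/
def corner (k : ℤ) (m : Fin n → ℤ) : EuclideanSpace ℝ (Fin n) :=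
  WithLp.toLp 2 fun i => 2 ^ k * (m i : ℝ)

lemma corner_mem_cube (k : ℤ) (m : Fin n → ℤ) : corner k m ∈ cube k m := by
  rw [mem_cube_iff_Ico]
  intro i
  have : (0 : ℝ) < 2 ^ k := by positivity
  simp [corner, this]

lemma dist_le_of_mem_cube {k : ℤ} {m : Fin n → ℤ} {x y : EuclideanSpace ℝ (Fin n)}
    (hx : x ∈ cube k m) (hy : y ∈ cube k m) : dist x y ≤ √n * 2 ^ k := by
  have h2 : (0 : ℝ) < 2 ^ k := by positivity
  rw [EuclideanSpace.dist_eq]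
  refine Real.sqrt_le_iff.2 ⟨by positivity, ?_⟩
  rw [mul_pow, Real.sq_sqrt (by positivity)]
  calc ∑ i, dist (x i) (y i) ^ 2 ≤ ∑ _i : Fin n, ((2 : ℝ) ^ k) ^ 2 := by
        refine Finset.sum_le_sum fun i _ => ?_
        have h1 := mem_cube_iff_Ico.1 hx i
        have h3 := mem_cube_iff_Ico.1 hy i
        refine pow_le_pow_left₀ dist_nonneg ?_ 2
        rw [Real.dist_eq, abs_le]
        constructor <;> linarith [h1.1, h1.2, h3.1, h3.2]
    _ = _ := by simp

lemma volume_closedBall (x : EuclideanSpace ℝ (Fin n)) {r : ℝ} (hr : 0 ≤ r) :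
    volume (Metric.closedBall x r) =
      ENNReal.ofReal (r ^ n) * volume (Metric.closedBall (0 : EuclideanSpace ℝ (Fin n)) 1) := by
  rw [Measure.addHaar_closedBall' _ _ hr]
  simp

lemma volume_unitBall_ne_top :
    volume (Metric.closedBall (0 : EuclideanSpace ℝ (Fin n)) 1) ≠ ∞ :=
  measure_closedBall_lt_top.ne

/-! ### Bumps -/

/-- Translated and dilated test kernels, adapted to the ball of centre `x` and radius `t`. -/
structure IsBump (α : ℝ) (x : EuclideanSpace ℝ (Fin n)) (t : ℝ)
    (ψ : EuclideanSpace ℝ (Fin n) → 𝕜) : Prop where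
  eq_zero : ∀ z, z ∉ Metric.closedBall x t → ψ z = 0
  integral_eq_zero : ∫ z, ψ z = 0
  holder : ∀ z z', ‖ψ z - ψ z'‖ ≤ (t ^ n)⁻¹ * (‖z - z'‖ / t) ^ α

lemma IsBump.zero {x : EuclideanSpace ℝ (Fin n)} {t : ℝ} (ht : 0 < t) :
    IsBump α x t (fun _ => (0 : 𝕜)) :=
  ⟨fun _ _ => rfl, by simp, fun z z' => by simp only [sub_zero, norm_zero]; positivity⟩

/-- The supremum of the pairings of `f` with the bumps adapted to a ball. -/
def bumpSup (α : ℝ) (f : EuclideanSpace ℝ (Fin n) → 𝕜) (x : EuclideanSpace ℝ (Fin n)) (t : ℝ) :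
    ℝ≥0∞ :=
  ⨆ (ψ : EuclideanSpace ℝ (Fin n) → 𝕜) (_ : IsBump α x t ψ), ‖∫ z, ψ z * f z‖ₑ

section bump

variable {x y : EuclideanSpace ℝ (Fin n)} {s t : ℝ} {ψ χ : EuclideanSpace ℝ (Fin n) → 𝕜}

/-- A displacement of length `3 t` leaves the ball, which has diameter at most `2 t`, so the bump
vanishes there and the Hölder bound gives `3 ^ α ≤ 3`. A vector of that length exists only in
positive dimension. -/
lemma IsBump.norm_le [Nontrivial (EuclideanSpace ℝ (Fin n))] (hα1 : α ≤ 1)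
    (ht : 0 < t) (h : IsBump α x t ψ) (z : EuclideanSpace ℝ (Fin n)) :
    ‖ψ z‖ ≤ 3 * (t ^ n)⁻¹ := by
  by_cases hz : z ∈ Metric.closedBall x t
  · obtain ⟨v, hv⟩ := _root_.exists_norm_eq (EuclideanSpace ℝ (Fin n))
      (show 0 ≤ 3 * t by positivity)
    have h0 : ψ (z - v) = 0 := by
      refine h.eq_zero _ fun hm => ?_
      rw [mem_closedBall_iff_norm] at hz hm
      have : v = (z - x) - (z - v - x) := by abel
      have h2 := norm_sub_le (z - x) (z - v - x)
      rw [← this] at h2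
      linarith
    have := h.holder z (z - v)
    rw [h0, sub_zero, sub_sub_cancel, hv, mul_div_assoc, div_self ht.ne', mul_one] at this
    refine this.trans ?_
    rw [mul_comm]
    have h3 : (3 : ℝ) ^ α ≤ 3 := by
      simpa using Real.rpow_le_rpow_of_exponent_le (show (1 : ℝ) ≤ 3 by norm_num) hα1
    gcongr
  · rw [h.eq_zero z hz, norm_zero]
    positivity

lemma IsBump.continuous (hα : 0 < α) (h : IsBump α x t ψ) : Continuous ψ := by
  refine continuous_iff_continuousAt.2 fun z => tendsto_iff_norm_sub_tendsto_zero.2 ?_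
  have hc : Continuous fun w : EuclideanSpace ℝ (Fin n) => (t ^ n)⁻¹ * (‖w - z‖ / t) ^ α :=
    continuous_const.mul (Continuous.rpow_const (by fun_prop) fun _ => Or.inr hα.le)
  have := hc.tendsto z
  simp only [sub_self, norm_zero, zero_div, Real.zero_rpow hα.ne', mul_zero] at this
  exact squeeze_zero (fun _ => norm_nonneg _) (fun w => h.holder w z) this

lemma IsBump.hasCompactSupport (h : IsBump α x t ψ) : HasCompactSupport ψ :=
  HasCompactSupport.intro (isCompact_closedBall x t) h.eq_zero

lemma IsBump.conj (h : IsBump α x t ψ) : IsBump α x t fun z => (starRingEnd 𝕜) (ψ z) where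
  eq_zero z hz := by simp [h.eq_zero z hz]
  integral_eq_zero := by rw [integral_conj, h.integral_eq_zero, map_zero]
  holder z z' := by rw [← map_sub, RCLike.norm_conj]; exact h.holder z z'

lemma IsBump.lintegral_le [Nontrivial (EuclideanSpace ℝ (Fin n))] (hα1 : α ≤ 1)
    (ht : 0 < t) (h : IsBump α x t ψ) :
    ∫⁻ z in Metric.closedBall x t, ‖ψ z‖ₑ ≤
      3 * volume (Metric.closedBall (0 : EuclideanSpace ℝ (Fin n)) 1) := by
  calc ∫⁻ z in Metric.closedBall x t, ‖ψ z‖ₑ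
      ≤ ∫⁻ _ in Metric.closedBall x t, ENNReal.ofReal (3 * (t ^ n)⁻¹) :=
        lintegral_mono fun z => by
          rw [← ofReal_norm]
          exact ENNReal.ofReal_le_ofReal (h.norm_le hα1 ht z)
    _ = _ := by
        rw [setLIntegral_const, volume_closedBall x ht.le, ← mul_assoc,
          ← ENNReal.ofReal_mul (by positivity), mul_assoc, inv_mul_cancel₀ (by positivity)]
        norm_num

/-- A function with mean value zero on a set of small diameter pairs weakly with a bump. -/
lemma IsBump.enorm_setIntegral_mul_le (hα : 0 < α) (ht : 0 < t)
    (h : IsBump α y t χ) {S : Set (EuclideanSpace ℝ (Fin n))} (hS : MeasurableSet S)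
    {u : EuclideanSpace ℝ (Fin n) → 𝕜} (hu : IntegrableOn u S) (hu0 : ∫ z in S, u z = 0)
    {c : EuclideanSpace ℝ (Fin n)} {ρ : ℝ} (hρ : ∀ z ∈ S, dist z c ≤ ρ) :
    ‖∫ z in S, χ z * u z‖ₑ ≤ ENNReal.ofReal ((t ^ n)⁻¹ * (ρ / t) ^ α) * ∫⁻ z in S, ‖u z‖ₑ := by
  have hbd : ∀ᵐ z ∂volume.restrict S, ‖χ z - χ c‖ ≤ (t ^ n)⁻¹ * (ρ / t) ^ α := by
    filter_upwards [ae_restrict_mem hS] with z hz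
    refine (h.holder z c).trans ?_
    have := hρ z hz
    rw [dist_eq_norm] at this
    gcongr
  have hm : AEStronglyMeasurable (fun z => χ z - χ c) (volume.restrict S) :=
    ((h.continuous hα).sub continuous_const).aestronglyMeasurable
  -- The mean zero of `u` allows the constant `χ c` to be subtracted, so only the oscillation of `χ`
  -- on `S` counts.
  have h1 : IntegrableOn (fun z => (χ z - χ c) * u z) S := hu.bdd_mul hm hbd
  have h2 : ∫ z in S, χ z * u z = ∫ z in S, (χ z - χ c) * u z := by
    have : ∀ z, χ z * u z = (χ z - χ c) * u z + χ c * u z := fun z => by ring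
    simp_rw [this]
    rw [integral_add h1 (hu.const_mul _), integral_const_mul, hu0, mul_zero, add_zero]
  rw [h2]
  refine (enorm_integral_le_lintegral_enorm _).trans ?_
  rw [← lintegral_const_mul' _ _ ENNReal.ofReal_ne_top]
  refine lintegral_mono_ae ?_
  filter_upwards [hbd] with z hz
  rw [enorm_mul]
  gcongr
  rw [← ofReal_norm]
  exact ENNReal.ofReal_le_ofReal hz

lemma IsBump.setIntegral_mul (h : IsBump α x t ψ) (f : EuclideanSpace ℝ (Fin n) → 𝕜) :
    ∫ z in Metric.closedBall x t, ψ z * f z = ∫ z, ψ z * f z :=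
  setIntegral_eq_integral_of_forall_compl_eq_zero fun z hz => by rw [h.eq_zero z hz, zero_mul]

/-- The cancellation is taken from `ψ` and the smoothness from `χ`, so the bound is a gain when `s ≤
t`. -/
lemma IsBump.enorm_integral_mul_bump_le [Nontrivial (EuclideanSpace ℝ (Fin n))]
    (hα : 0 < α) (hα1 : α ≤ 1) (hs : 0 < s) (ht : 0 < t)
    (h : IsBump α x s ψ) (h' : IsBump α y t χ) :
    ‖∫ z, χ z * ψ z‖ₑ ≤ ENNReal.ofReal ((t ^ n)⁻¹ * (s / t) ^ α) *
      (3 * volume (Metric.closedBall (0 : EuclideanSpace ℝ (Fin n)) 1)) := by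
  have hint : Integrable ψ := (h.continuous hα).integrable_of_hasCompactSupport h.hasCompactSupport
  have h0 : ∫ z in Metric.closedBall x s, ψ z = 0 := by
    rw [setIntegral_eq_integral_of_forall_compl_eq_zero h.eq_zero, h.integral_eq_zero]
  have h1 := h'.enorm_setIntegral_mul_le hα ht (S := Metric.closedBall x s)
    measurableSet_closedBall hint.integrableOn h0 (c := x) (ρ := s) fun z hz => hz
  have h2 : ∫ z in Metric.closedBall x s, χ z * ψ z = ∫ z, χ z * ψ z :=
    setIntegral_eq_integral_of_forall_compl_eq_zero fun z hz => by rw [h.eq_zero z hz, mul_zero]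
  rw [h2] at h1
  refine h1.trans ?_
  gcongr
  exact h.lintegral_le hα1 hs

lemma IsBump.integral_mul_bump_eq_zero (h : IsBump α x s ψ) (h' : IsBump α y t χ)
    (hxy : s + t < dist x y) : ∫ z, χ z * ψ z = 0 := by
  rw [← integral_zero (EuclideanSpace ℝ (Fin n)) 𝕜]
  congr 1
  funext z
  by_cases hz : z ∈ Metric.closedBall x s
  · rw [h'.eq_zero z, zero_mul]
    intro hz'
    rw [Metric.mem_closedBall] at hz hz'
    linarith [dist_triangle_left x y z]
  · rw [h.eq_zero z hz, mul_zero]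

lemma IsBump.enorm_integral_mul_le [Nontrivial (EuclideanSpace ℝ (Fin n))]
    (hα1 : α ≤ 1) (ht : 0 < t) (h : IsBump α x t ψ)
    (f : EuclideanSpace ℝ (Fin n) → 𝕜) :
    ‖∫ z, ψ z * f z‖ₑ ≤
      ENNReal.ofReal (3 * (t ^ n)⁻¹) * ∫⁻ z in Metric.closedBall x t, ‖f z‖ₑ := by
  rw [← h.setIntegral_mul]
  refine (enorm_integral_le_lintegral_enorm _).trans ?_
  rw [← lintegral_const_mul' _ _ ENNReal.ofReal_ne_top]
  refine lintegral_mono fun z => ?_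
  rw [enorm_mul]
  gcongr
  rw [← ofReal_norm]
  exact ENNReal.ofReal_le_ofReal (h.norm_le hα1 ht z)

lemma IsBump.integrable_mul (hα : 0 < α) (h : IsBump α x t ψ)
    {f : EuclideanSpace ℝ (Fin n) → 𝕜} (hf : LocallyIntegrable f) :
    Integrable fun z => ψ z * f z := by
  simpa only [smul_eq_mul] using
    hf.integrable_smul_left_of_hasCompactSupport (h.continuous hα) h.hasCompactSupport

end bump

/-- `∑ₖ (sup over bumps at scale 2ᵏ)²`, a discrete majorant of the square of `g_α`. -/
def discreteG (α : ℝ) (f : EuclideanSpace ℝ (Fin n) → 𝕜) (x : EuclideanSpace ℝ (Fin n)) : ℝ≥0∞ :=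
  ∑' k : ℤ, bumpSup α f x (2 ^ k) ^ 2

lemma bumpSup_add_le (hα : 0 < α) {f g : EuclideanSpace ℝ (Fin n) → 𝕜}
    (hf : LocallyIntegrable f) (hg : LocallyIntegrable g) (x : EuclideanSpace ℝ (Fin n)) (t : ℝ) :
    bumpSup α (fun z => f z + g z) x t ≤ bumpSup α f x t + bumpSup α g x t := by
  refine iSup₂_le fun ψ hψ => ?_
  simp_rw [mul_add]
  rw [integral_add (hψ.integrable_mul hα hf) (hψ.integrable_mul hα hg)]
  exact (enorm_add_le _ _).trans
    (add_le_add (le_iSup₂ (f := fun ψ (_ : IsBump α x t ψ) => ‖∫ z, ψ z * f z‖ₑ) ψ hψ)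
      (le_iSup₂ (f := fun ψ (_ : IsBump α x t ψ) => ‖∫ z, ψ z * g z‖ₑ) ψ hψ))

lemma add_sq_le_two_mul (a b : ℝ≥0∞) : (a + b) ^ 2 ≤ 2 * a ^ 2 + 2 * b ^ 2 := by
  have := ENNReal.rpow_add_le_mul_rpow_add_rpow a b (p := 2) (by norm_num)
  norm_num [mul_add] at this
  exact this

lemma discreteG_add_le (hα : 0 < α) {f g : EuclideanSpace ℝ (Fin n) → 𝕜}
    (hf : LocallyIntegrable f) (hg : LocallyIntegrable g) (x : EuclideanSpace ℝ (Fin n)) :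
    discreteG α (fun z => f z + g z) x ≤ 2 * discreteG α f x + 2 * discreteG α g x := by
  unfold discreteG
  rw [← ENNReal.tsum_mul_left, ← ENNReal.tsum_mul_left, ← ENNReal.tsum_add]
  refine ENNReal.tsum_le_tsum fun k => ?_
  exact (pow_le_pow_left' (bumpSup_add_le hα hf hg x _) 2).trans (add_sq_le_two_mul _ _)

/-- The embedding of `ℓ¹` in `ℓ²`. It reduces the square function to a plain sum over scales for the
bad part and for the distant part, where the scales already decay. -/
lemma tsum_sq_le_sq_tsum {ι : Type*} (a : ι → ℝ≥0∞) : ∑' i, a i ^ 2 ≤ (∑' i, a i) ^ 2 := by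
  rw [sq, ← ENNReal.tsum_mul_right]
  refine ENNReal.tsum_le_tsum fun i => ?_
  rw [sq]
  gcongr
  exact ENNReal.le_tsum i

/-! ### An almost-orthogonality inequality of Boas–Bellman type -/

open scoped InnerProductSpace in
-- Duality: for `y = ∑ w i c i v i` the left side `S` equals `⟪y, f⟫`, so `S ≤ ‖y‖ ‖f‖`. Expanding
-- `‖y‖ ^ 2` and using `2 |c i| |c j| ≤ |c i| ^ 2 + |c j| ^ 2` with the row-sum hypothesis gives
-- `‖y‖ ^ 2 ≤ C S`. One factor `S` then cancels.
lemma sum_mul_norm_inner_sq_le {H ι : Type*} [NormedAddCommGroup H] [InnerProductSpace 𝕜 H]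
    (s : Finset ι) {w : ι → ℝ} (hw : ∀ i, 0 ≤ w i) (v : ι → H) (f : H) {C : ℝ}
    (hC : 0 ≤ C) (h : ∀ i ∈ s, ∑ j ∈ s, w j * ‖⟪v i, v j⟫_𝕜‖ ≤ C) :
    ∑ i ∈ s, w i * ‖⟪v i, f⟫_𝕜‖ ^ 2 ≤ C * ‖f‖ ^ 2 := by
  set c : ι → 𝕜 := fun i => ⟪v i, f⟫_𝕜 with hc
  set S : ℝ := ∑ i ∈ s, w i * ‖c i‖ ^ 2 with hS
  have hS0 : 0 ≤ S := Finset.sum_nonneg fun i _ => mul_nonneg (hw i) (by positivity)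
  set y : H := ∑ i ∈ s, ((w i : 𝕜) * c i) • v i with hy
  have h1 : ⟪y, f⟫_𝕜 = (S : 𝕜) := by
    rw [hy, sum_inner, hS]
    push_cast
    refine Finset.sum_congr rfl fun i _ => ?_
    rw [inner_smul_left, map_mul, RCLike.conj_ofReal, mul_assoc]
    change (w i : 𝕜) * ((starRingEnd 𝕜) (c i) * c i) = _
    rw [RCLike.conj_mul]
  have h2 : S ≤ ‖y‖ * ‖f‖ := by
    have := norm_inner_le_norm (𝕜 := 𝕜) y f
    rwa [h1, RCLike.norm_ofReal, abs_of_nonneg hS0] at this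
  have h3 : ‖y‖ ^ 2 ≤ C * S := by
    have e1 : ‖y‖ ^ 2 = ‖⟪y, y⟫_𝕜‖ := by
      rw [inner_self_eq_norm_sq_to_K, ← RCLike.ofReal_pow, RCLike.norm_ofReal,
        abs_of_nonneg (by positivity)]
    have e2 : ⟪y, y⟫_𝕜 = ∑ i ∈ s, ∑ j ∈ s,
        (starRingEnd 𝕜) ((w i : 𝕜) * c i) * (((w j : 𝕜) * c j) * ⟪v i, v j⟫_𝕜) := by
      conv_lhs => rw [hy]
      rw [sum_inner]
      refine Finset.sum_congr rfl fun i _ => ?_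
      rw [inner_smul_left, inner_sum, Finset.mul_sum]
      refine Finset.sum_congr rfl fun j _ => ?_
      rw [inner_smul_right]
    have e3 : ‖y‖ ^ 2 ≤ ∑ i ∈ s, ∑ j ∈ s,
        (w i * w j * ‖⟪v i, v j⟫_𝕜‖ * ‖c i‖ ^ 2 / 2 + w i * w j * ‖⟪v i, v j⟫_𝕜‖ * ‖c j‖ ^ 2 / 2) := by
      rw [e1, e2]
      refine (norm_sum_le _ _).trans (Finset.sum_le_sum fun i _ => ?_)
      refine (norm_sum_le _ _).trans (Finset.sum_le_sum fun j _ => ?_)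
      rw [norm_mul, RCLike.norm_conj, norm_mul, norm_mul, norm_mul, RCLike.norm_ofReal,
        RCLike.norm_ofReal, abs_of_nonneg (hw i), abs_of_nonneg (hw j)]
      have hp : 0 ≤ w i * w j * ‖⟪v i, v j⟫_𝕜‖ :=
        mul_nonneg (mul_nonneg (hw i) (hw j)) (norm_nonneg _)
      nlinarith [mul_nonneg hp (sq_nonneg (‖c i‖ - ‖c j‖))]
    have e4 : ∑ i ∈ s, ∑ j ∈ s, w i * w j * ‖⟪v i, v j⟫_𝕜‖ * ‖c i‖ ^ 2 / 2 ≤ C * S / 2 := by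
      rw [hS, Finset.mul_sum, Finset.sum_div]
      refine Finset.sum_le_sum fun i hi => ?_
      have := mul_le_mul_of_nonneg_left (h i hi)
        (show 0 ≤ w i * ‖c i‖ ^ 2 / 2 from div_nonneg (mul_nonneg (hw i) (by positivity)) (by norm_num))
      rw [Finset.mul_sum] at this
      refine (Finset.sum_le_sum fun j _ => ?_).trans (this.trans ?_) <;>
      exact le_of_eq (by ring)
    have e5 : ∑ i ∈ s, ∑ j ∈ s, w i * w j * ‖⟪v i, v j⟫_𝕜‖ * ‖c j‖ ^ 2 / 2 =
        ∑ i ∈ s, ∑ j ∈ s, w i * w j * ‖⟪v i, v j⟫_𝕜‖ * ‖c i‖ ^ 2 / 2 := by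
      rw [Finset.sum_comm]
      refine Finset.sum_congr rfl fun i _ => Finset.sum_congr rfl fun j _ => ?_
      rw [norm_inner_symm, mul_comm (w j)]
    simp_rw [Finset.sum_add_distrib] at e3
    rw [e5] at e3
    linarith
  rcases hS0.eq_or_lt with h0 | h0
  · rw [← h0]
    positivity
  · have : S * S ≤ C * ‖f‖ ^ 2 * S := by
      calc S * S ≤ (‖y‖ * ‖f‖) * (‖y‖ * ‖f‖) := mul_self_le_mul_self hS0 h2
        _ = ‖y‖ ^ 2 * ‖f‖ ^ 2 := by ring
        _ ≤ C * S * ‖f‖ ^ 2 := by gcongr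
        _ = _ := by ring
    exact le_of_mul_le_mul_right this h0

/-! ### Almost orthogonality of bumps at dyadic scales -/

/-- The decay of the pairing of bumps at scales which differ by a factor `2 ^ d`. -/
def scaleDecay (α : ℝ) (d : ℤ) : ℝ≥0∞ := ENNReal.ofReal ((2 ^ (-|d|) : ℝ) ^ α)

lemma two_zpow_neg_rpow (α : ℝ) (k : ℕ) : ((2 : ℝ) ^ (-(k : ℤ))) ^ α = ((2 : ℝ) ^ (-α)) ^ k := by
  rw [← Real.rpow_intCast, ← Real.rpow_mul (by norm_num), ← Real.rpow_natCast,
    ← Real.rpow_mul (by norm_num)]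
  congr 1
  push_cast
  ring

lemma two_rpow_neg_lt_one (hα : 0 < α) : (2 : ℝ) ^ (-α) < 1 :=
  Real.rpow_lt_one_of_one_lt_of_neg (by norm_num) (by linarith)

lemma tsum_scaleDecay_ne_top (hα : 0 < α) : ∑' d : ℤ, scaleDecay α d ≠ ∞ := by
  have hs : Summable fun k : ℕ => ((2 : ℝ) ^ (-α)) ^ k :=
    summable_geometric_of_lt_one (by positivity) (two_rpow_neg_lt_one hα)
  have : Summable fun d : ℤ => ((2 : ℝ) ^ (-|d|)) ^ α := by
    refine Summable.of_nat_of_neg ?_ ?_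
    · refine hs.congr fun k => ?_
      rw [Nat.abs_cast, two_zpow_neg_rpow]
    · refine hs.congr fun k => ?_
      rw [abs_neg, Nat.abs_cast, two_zpow_neg_rpow]
  exact this.tsum_ofReal_ne_top

/-- The constant in the almost-orthogonality estimate. -/
def schurConst (n : ℕ) (α : ℝ) : ℝ≥0∞ :=
  (∑' d : ℤ, scaleDecay α d) *
    (3 * volume (Metric.closedBall (0 : EuclideanSpace ℝ (Fin n)) 1) *
      (ENNReal.ofReal ((2 + √n) ^ n) * volume (Metric.closedBall (0 : EuclideanSpace ℝ (Fin n)) 1)))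

lemma schurConst_ne_top (hα : 0 < α) : schurConst n α ≠ ∞ := by
  unfold schurConst
  refine ENNReal.mul_ne_top (tsum_scaleDecay_ne_top hα) (ENNReal.mul_ne_top
    (ENNReal.mul_ne_top (by simp) volume_unitBall_ne_top)
    (ENNReal.mul_ne_top ENNReal.ofReal_ne_top volume_unitBall_ne_top))

lemma tsum_volume_cube_inter_le (j : ℤ) {B : Set (EuclideanSpace ℝ (Fin n))}
    (hB : MeasurableSet B) : ∑' m, volume (cube j m ∩ B) ≤ volume B := by
  rw [← measure_iUnion]
  · exact measure_mono (iUnion_subset fun m => inter_subset_right)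
  · exact fun m m' h => (disjoint_cube h).mono inter_subset_left inter_subset_left
  · exact fun m => (measurableSet_cube j m).inter hB

/-- If the pairing is nonzero, the two supports meet and the whole cube lies in the ball on the
right. Keeping the volume of the intersection allows the sum over all cubes of one scale to be
bounded by the volume of that ball. -/
lemma IsBump.mul_volume_cube_le [Nontrivial (EuclideanSpace ℝ (Fin n))]
    (hα : 0 < α) (hα1 : α ≤ 1) {k j : ℤ} {m : Fin n → ℤ} {x y : EuclideanSpace ℝ (Fin n)}
    {ψ χ : EuclideanSpace ℝ (Fin n) → 𝕜} (hψ : IsBump α x (2 ^ k) ψ) (hχ : IsBump α y (2 ^ j) χ)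
    (hy : y ∈ cube j m) :
    volume (cube j m) * ‖∫ z, χ z * ψ z‖ₑ ≤
      scaleDecay α (j - k) * ENNReal.ofReal ((((2 : ℝ) ^ (max k j)) ^ n)⁻¹) *
        (3 * volume (Metric.closedBall (0 : EuclideanSpace ℝ (Fin n)) 1)) *
        volume (cube j m ∩ Metric.closedBall x ((2 + √n) * 2 ^ (max k j))) := by
  have hk : (0 : ℝ) < 2 ^ k := by positivity
  have hj : (0 : ℝ) < 2 ^ j := by positivity
  have hkM : (2 : ℝ) ^ k ≤ 2 ^ max k j := zpow_le_zpow_right₀ (by norm_num) (le_max_left _ _)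
  have hjM : (2 : ℝ) ^ j ≤ 2 ^ max k j := zpow_le_zpow_right₀ (by norm_num) (le_max_right _ _)
  by_cases hxy : 2 ^ k + 2 ^ j < dist x y
  · rw [hψ.integral_mul_bump_eq_zero hχ hxy]
    simp
  push Not at hxy
  have hsub : cube j m ⊆ Metric.closedBall x ((2 + √n) * 2 ^ (max k j)) := by
    intro z hz
    rw [Metric.mem_closedBall]
    have h1 := dist_le_of_mem_cube hz hy
    have h2 : √n * (2 : ℝ) ^ j ≤ √n * 2 ^ max k j := by gcongr
    have h3 := dist_triangle z y x
    rw [dist_comm y x] at h3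
    linarith
  rw [inter_eq_left.2 hsub, mul_comm]
  refine mul_le_mul_left ?_ _
  rcases le_total j k with h | h
  -- Here `χ` has the smaller scale, so its mean zero is used against the smoothness of `ψ`; in the
  -- other case the roles are exchanged.
  · have := hχ.enorm_integral_mul_bump_le hα hα1 hj hk hψ
    simp_rw [mul_comm (ψ _)] at this
    refine this.trans (le_of_eq ?_)
    rw [max_eq_left h, mul_comm ((_)⁻¹ : ℝ), ENNReal.ofReal_mul (by positivity), scaleDecay,
      ← zpow_sub₀ two_ne_zero, abs_of_nonpos (by linarith), neg_neg]
  · have := hψ.enorm_integral_mul_bump_le hα hα1 hk hj hχ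
    refine this.trans (le_of_eq ?_)
    rw [max_eq_right h, mul_comm ((_)⁻¹ : ℝ), ENNReal.ofReal_mul (by positivity), scaleDecay,
      ← zpow_sub₀ two_ne_zero, abs_of_nonneg (by linarith), neg_sub]

/-- This is the row-sum hypothesis of the Boas–Bellman inequality. At scale `j` the volume of the
ball cancels the normalisation `2 ^ (-n max k j)` up to a constant, leaving `scaleDecay α (j - k)`,
which is summable in `j`. -/
lemma IsBump.tsum_volume_mul_le [Nontrivial (EuclideanSpace ℝ (Fin n))]
    (hα : 0 < α) (hα1 : α ≤ 1) {k : ℤ} {x : EuclideanSpace ℝ (Fin n)}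
    {ψ : EuclideanSpace ℝ (Fin n) → 𝕜} (hψ : IsBump α x (2 ^ k) ψ)
    {y : ℤ × (Fin n → ℤ) → EuclideanSpace ℝ (Fin n)}
    {χ : ℤ × (Fin n → ℤ) → EuclideanSpace ℝ (Fin n) → 𝕜}
    (hy : ∀ i, y i ∈ cube i.1 i.2) (hχ : ∀ i, IsBump α (y i) (2 ^ i.1) (χ i)) :
    ∑' i : ℤ × (Fin n → ℤ), volume (cube i.1 i.2) * ‖∫ z, χ i z * ψ z‖ₑ ≤ schurConst n α := by
  have hsum : ∑' j : ℤ, scaleDecay α (j - k) = ∑' d : ℤ, scaleDecay α d :=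
    (Equiv.subRight k).tsum_eq (scaleDecay α)
  rw [ENNReal.tsum_prod', schurConst, ← hsum, ← ENNReal.tsum_mul_right]
  refine ENNReal.tsum_le_tsum fun j => ?_
  refine (ENNReal.tsum_le_tsum fun m =>
    hψ.mul_volume_cube_le hα hα1 (hχ (j, m)) (hy (j, m))).trans ?_
  dsimp only
  rw [ENNReal.tsum_mul_left]
  have hM : (0 : ℝ) < 2 ^ max k j := by positivity
  refine (mul_le_mul_right (tsum_volume_cube_inter_le j measurableSet_closedBall) _).trans ?_
  rw [volume_closedBall x (by positivity), mul_pow, mul_comm ((2 + √n) ^ n),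
    ENNReal.ofReal_mul (by positivity)]
  have h1 : ENNReal.ofReal ((((2 : ℝ) ^ (max k j)) ^ n)⁻¹) *
      ENNReal.ofReal (((2 : ℝ) ^ (max k j)) ^ n) = 1 := by
    rw [← ENNReal.ofReal_mul (by positivity), inv_mul_cancel₀ (by positivity), ENNReal.ofReal_one]
  generalize ENNReal.ofReal ((((2 : ℝ) ^ (max k j)) ^ n)⁻¹) = a at *
  generalize ENNReal.ofReal (((2 : ℝ) ^ (max k j)) ^ n) = b at *
  generalize volume (Metric.closedBall (0 : EuclideanSpace ℝ (Fin n)) 1) = V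
  generalize ENNReal.ofReal ((2 + √n) ^ n) = R
  calc _ = scaleDecay α (j - k) * (3 * V * (R * V)) * (a * b) := by ring
    _ ≤ _ := by rw [h1, mul_one]

/-- One bump per dyadic cube: the weighted `ℓ²` norm of the pairings with `f ∈ L²`. -/
lemma sum_volume_mul_enorm_sq_le [Nontrivial (EuclideanSpace ℝ (Fin n))]
    (hα : 0 < α) (hα1 : α ≤ 1) {f : EuclideanSpace ℝ (Fin n) → 𝕜} (hf : MemLp f 2)
    {y : ℤ × (Fin n → ℤ) → EuclideanSpace ℝ (Fin n)}
    {χ : ℤ × (Fin n → ℤ) → EuclideanSpace ℝ (Fin n) → 𝕜}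
    (hy : ∀ i, y i ∈ cube i.1 i.2) (hχ : ∀ i, IsBump α (y i) (2 ^ i.1) (χ i))
    (s : Finset (ℤ × (Fin n → ℤ))) :
    ∑ i ∈ s, volume (cube i.1 i.2) * ‖∫ z, χ i z * f z‖ₑ ^ 2 ≤
      schurConst n α * ∫⁻ z, ‖f z‖ₑ ^ 2 := by
  -- The inner product conjugates its first argument, hence the conjugated bumps.
  have hmem : ∀ i, MemLp (fun z => (starRingEnd 𝕜) (χ i z)) 2 (volume : Measure (EuclideanSpace ℝ (Fin n))) :=
    fun i => ((hχ i).conj.continuous hα).memLp_of_hasCompactSupport (hχ i).conj.hasCompactSupport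
  have hinner : ∀ i, ∀ {g : EuclideanSpace ℝ (Fin n) → 𝕜} (hg : MemLp g 2),
      inner 𝕜 ((hmem i).toLp) (hg.toLp) = ∫ z, χ i z * g z := by
    intro i g hg
    rw [L2.inner_def]
    refine integral_congr_ae ?_
    filter_upwards [(hmem i).coeFn_toLp, hg.coeFn_toLp] with z h1 h2
    rw [h1, h2, RCLike.inner_apply, RCLike.conj_conj, mul_comm]
  have hvol : ∀ i : ℤ × (Fin n → ℤ), volume (cube i.1 i.2) ≠ ∞ := fun i => by
    rw [volume_cube]; exact ENNReal.ofReal_ne_top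
  have key := sum_mul_norm_inner_sq_le (𝕜 := 𝕜) s (w := fun i => (volume (cube i.1 i.2)).toReal)
    (fun i => ENNReal.toReal_nonneg) (fun i => (hmem i).toLp) hf.toLp
    (C := (schurConst n α).toReal) ENNReal.toReal_nonneg (by
      intro i _
      rw [← ENNReal.ofReal_le_iff_le_toReal (schurConst_ne_top hα),
        ENNReal.ofReal_sum_of_nonneg fun j _ => by positivity]
      refine le_trans ?_ ((hχ i).conj.tsum_volume_mul_le hα hα1 hy hχ)
      refine le_trans (Finset.sum_le_sum fun j _ => ?_) (ENNReal.sum_le_tsum s)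
      rw [ENNReal.ofReal_mul (by positivity), ENNReal.ofReal_toReal (hvol j), norm_inner_symm,
        hinner j (hmem i), ofReal_norm])
  have hfn : ENNReal.ofReal (‖hf.toLp‖ ^ 2) = ∫⁻ z, ‖f z‖ₑ ^ 2 := by
    have := eLpNorm_nnreal_pow_eq_lintegral (f := f) (μ := volume) (p := 2) (by norm_num)
    rw [ENNReal.ofReal_pow (norm_nonneg _), ofReal_norm, Lp.enorm_toLp]
    norm_num at this
    exact this
  rw [← hfn, ← ENNReal.ofReal_toReal (schurConst_ne_top (n := n) hα),
    ← ENNReal.ofReal_mul ENNReal.toReal_nonneg]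
  refine le_trans (le_of_eq ?_) (ENNReal.ofReal_le_ofReal key)
  rw [ENNReal.ofReal_sum_of_nonneg fun j _ => by positivity]
  refine Finset.sum_congr rfl fun i _ => ?_
  rw [ENNReal.ofReal_mul (by positivity), ENNReal.ofReal_toReal (hvol i),
    ENNReal.ofReal_pow (norm_nonneg _), ofReal_norm, hinner i hf]

/-- The supremum of `bumpSup` over a dyadic cube. -/
def cubeSup (α : ℝ) (f : EuclideanSpace ℝ (Fin n) → 𝕜) (i : ℤ × (Fin n → ℤ)) : ℝ≥0∞ :=
  ⨆ x ∈ cube i.1 i.2, bumpSup α f x (2 ^ i.1)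

/-- In each cube a point and a bump attaining at least half of the supremum are selected; squaring
this half produces the factor `4`. -/
lemma sum_volume_mul_cubeSup_sq_le [Nontrivial (EuclideanSpace ℝ (Fin n))]
    (hα : 0 < α) (hα1 : α ≤ 1) {f : EuclideanSpace ℝ (Fin n) → 𝕜} (hf : MemLp f 2)
    (s : Finset (ℤ × (Fin n → ℤ))) :
    ∑ i ∈ s, volume (cube i.1 i.2) * cubeSup α f i ^ 2 ≤
      4 * schurConst n α * ∫⁻ z, ‖f z‖ₑ ^ 2 := by
  classical
  have hfin : schurConst n α * ∫⁻ z, ‖f z‖ₑ ^ 2 < ∞ := by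
    refine ENNReal.mul_lt_top (schurConst_ne_top hα).lt_top ?_
    have := hf.eLpNorm_lt_top
    have h2 := eLpNorm_nnreal_pow_eq_lintegral (f := f) (μ := volume) (p := 2) (by norm_num)
    norm_num at h2
    rw [← h2]
    exact ENNReal.pow_lt_top this
  have hvol : ∀ i : ℤ × (Fin n → ℤ), volume (cube i.1 i.2) ≠ ∞ := fun i => by
    rw [volume_cube]; exact ENNReal.ofReal_ne_top
  have hvol0 : ∀ i : ℤ × (Fin n → ℤ), volume (cube i.1 i.2) ≠ 0 := fun i => by
    rw [volume_cube, ENNReal.ofReal_ne_zero_iff]; positivity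
  -- A single bump is tested by completing it to a full family with zero bumps at the corners.
  have hone : ∀ (i : ℤ × (Fin n → ℤ)) x, x ∈ cube i.1 i.2 → ∀ ψ : EuclideanSpace ℝ (Fin n) → 𝕜,
      IsBump α x (2 ^ i.1) ψ →
      volume (cube i.1 i.2) * ‖∫ z, ψ z * f z‖ₑ ^ 2 ≤ schurConst n α * ∫⁻ z, ‖f z‖ₑ ^ 2 := by
    intro i x hx ψ hψ
    have := sum_volume_mul_enorm_sq_le hα hα1 hf
      (y := Function.update (fun i => corner i.1 i.2) i x)
      (χ := Function.update (fun _ _ => 0) i ψ) (fun j => by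
        rcases eq_or_ne j i with rfl | hj
        · simpa using hx
        · simpa [hj] using corner_mem_cube j.1 j.2) (fun j => by
        rcases eq_or_ne j i with rfl | hj
        · simpa using hψ
        · simpa [hj] using IsBump.zero (by positivity)) {i}
    simpa using this
  -- Half of the supremum lies strictly below it only if the supremum is finite, which follows from
  -- the bound for a single cube.
  have htop : ∀ i, cubeSup α f i ≠ ∞ := by
    intro i
    have : cubeSup α f i ≤
        ((volume (cube i.1 i.2))⁻¹ * (schurConst n α * ∫⁻ z, ‖f z‖ₑ ^ 2)) ^ (1 / 2 : ℝ) := by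
      refine iSup₂_le fun x hx => iSup₂_le fun ψ hψ => ?_
      rw [one_div, ENNReal.le_rpow_inv_iff (by norm_num), ENNReal.rpow_ofNat,
        ← ENNReal.mul_le_iff_le_inv (hvol0 i) (hvol i)]
      exact hone i x hx ψ hψ
    refine ne_top_of_le_ne_top ?_ this
    refine ENNReal.rpow_ne_top_of_nonneg (by norm_num) ?_
    exact ENNReal.mul_ne_top (ENNReal.inv_ne_top.2 (hvol0 i)) hfin.ne
  have hex : ∀ i, ∃ x ∈ cube i.1 i.2, ∃ ψ : EuclideanSpace ℝ (Fin n) → 𝕜,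
      IsBump α x (2 ^ i.1) ψ ∧ cubeSup α f i ≤ 2 * ‖∫ z, ψ z * f z‖ₑ := by
    intro i
    by_cases h0 : cubeSup α f i = 0
    · exact ⟨_, corner_mem_cube i.1 i.2, _, IsBump.zero (by positivity), by simp [h0]⟩
    have hlt : cubeSup α f i / 2 < cubeSup α f i := ENNReal.half_lt_self h0 (htop i)
    conv_rhs at hlt => unfold cubeSup bumpSup
    simp only [lt_iSup_iff] at hlt
    obtain ⟨x, hx, ψ, hψ, hlt⟩ := hlt
    refine ⟨x, hx, ψ, hψ, ?_⟩
    rw [mul_comm]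
    exact (ENNReal.div_le_iff (by norm_num) (by norm_num)).1 hlt.le
  choose y hy χ hχ hle using hex
  calc ∑ i ∈ s, volume (cube i.1 i.2) * cubeSup α f i ^ 2
      ≤ ∑ i ∈ s, 4 * (volume (cube i.1 i.2) * ‖∫ z, χ i z * f z‖ₑ ^ 2) := by
        refine Finset.sum_le_sum fun i _ => ?_
        calc _ ≤ volume (cube i.1 i.2) * (2 * ‖∫ z, χ i z * f z‖ₑ) ^ 2 := by
              gcongr
              exact hle i
          _ = _ := by ring
    _ ≤ _ := by
        rw [← Finset.mul_sum, mul_assoc]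
        gcongr
        exact sum_volume_mul_enorm_sq_le hα hα1 hf hy hχ s

/-- `g_α` is bounded on `L²`. -/
lemma lintegral_discreteG_le [Nontrivial (EuclideanSpace ℝ (Fin n))]
    (hα : 0 < α) (hα1 : α ≤ 1) {f : EuclideanSpace ℝ (Fin n) → 𝕜} (hf : MemLp f 2) :
    ∃ H : EuclideanSpace ℝ (Fin n) → ℝ≥0∞, Measurable H ∧ (∀ x, discreteG α f x ≤ H x) ∧
      ∫⁻ x, H x ≤ 4 * schurConst n α * ∫⁻ z, ‖f z‖ₑ ^ 2 := by
  -- At each scale the majorant is constant on cubes, hence measurable.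
  refine ⟨fun x => ∑' i : ℤ × (Fin n → ℤ),
    (cube i.1 i.2).indicator (fun _ => cubeSup α f i ^ 2) x, ?_, ?_, ?_⟩
  · exact Measurable.tsum fun i => measurable_const.indicator (measurableSet_cube _ _)
  · intro x
    dsimp only
    rw [ENNReal.tsum_prod', discreteG]
    refine ENNReal.tsum_le_tsum fun k => ?_
    refine le_trans ?_ (ENNReal.le_tsum (cubeIndex k x))
    rw [indicator_of_mem (show x ∈ cube k (cubeIndex k x) from rfl)]
    gcongr
    exact le_iSup₂ (f := fun y (_ : y ∈ cube k (cubeIndex k x)) => bumpSup α f y (2 ^ k)) x rfl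
  · rw [lintegral_tsum fun i =>
      (measurable_const.indicator (measurableSet_cube _ _)).aemeasurable]
    simp_rw [lintegral_indicator (measurableSet_cube _ _), setLIntegral_const, mul_comm (_ ^ 2)]
    rw [ENNReal.tsum_eq_iSup_sum]
    exact iSup_le fun s => sum_volume_mul_cubeSup_sq_le hα hα1 hf s

/-! ### The Calderón–Zygmund decomposition -/

/-- The average of `‖f‖` over the dyadic cube exceeds `l`. -/
def IsHeavy (f : EuclideanSpace ℝ (Fin n) → 𝕜) (l : ℝ) (k : ℤ) (m : Fin n → ℤ) : Prop :=
  ENNReal.ofReal l * volume (cube k m) < ∫⁻ z in cube k m, ‖f z‖ₑ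

/-- The maximal heavy cubes. -/
def stoppingCubes (f : EuclideanSpace ℝ (Fin n) → 𝕜) (l : ℝ) : Set (ℤ × (Fin n → ℤ)) :=
  {i | IsHeavy f l i.1 i.2 ∧
    ∃ x ∈ cube i.1 i.2, ∀ j, i.1 < j → ¬ IsHeavy f l j (cubeIndex j x)}

lemma stoppingCubes_fst_le {f : EuclideanSpace ℝ (Fin n) → 𝕜} {l : ℝ} {i i' : ℤ × (Fin n → ℤ)}
    (hi : i ∈ stoppingCubes f l) (hi' : i' ∈ stoppingCubes f l) {z : EuclideanSpace ℝ (Fin n)}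
    (hz : z ∈ cube i.1 i.2) (hz' : z ∈ cube i'.1 i'.2) : i'.1 ≤ i.1 := by
  by_contra! hlt
  obtain ⟨x, hx, hmax⟩ := hi.2
  have h1 : cubeIndex i'.1 x = i'.2 :=
    (cubeIndex_eq_of_le hlt.le (hx.trans hz.symm)).trans hz'
  exact hmax i'.1 hlt (h1 ▸ hi'.1)

lemma disjoint_stoppingCubes {f : EuclideanSpace ℝ (Fin n) → 𝕜} {l : ℝ}
    {i i' : ℤ × (Fin n → ℤ)} (hi : i ∈ stoppingCubes f l) (hi' : i' ∈ stoppingCubes f l)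
    (hne : i ≠ i') : Disjoint (cube i.1 i.2) (cube i'.1 i'.2) := by
  refine Set.disjoint_left.2 fun z hz hz' => hne ?_
  have h1 : i.1 = i'.1 :=
    le_antisymm (stoppingCubes_fst_le hi' hi hz' hz) (stoppingCubes_fst_le hi hi' hz hz')
  refine Prod.ext h1 ?_
  rw [← mem_cube.1 hz, ← mem_cube.1 hz', h1]

/-- A heavy cube has volume below `‖f‖₁ / l`. In positive dimension this bounds its side, so among
the heavy cubes containing `x` there is a largest one. -/
lemma exists_mem_stoppingCubes [Nontrivial (EuclideanSpace ℝ (Fin n))]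
    {f : EuclideanSpace ℝ (Fin n) → 𝕜} (hf : Integrable f) {l : ℝ} (hl : 0 < l)
    {x : EuclideanSpace ℝ (Fin n)} {k : ℤ} (hk : IsHeavy f l k (cubeIndex k x)) :
    ∃ i ∈ stoppingCubes f l, x ∈ cube i.1 i.2 := by
  have hn : n ≠ 0 := by
    rintro rfl
    exact not_subsingleton (EuclideanSpace ℝ (Fin 0)) inferInstance
  set I : ℝ := (∫⁻ z, ‖f z‖ₑ).toReal with hI
  have hIf : ∫⁻ z, ‖f z‖ₑ ≠ ∞ := hf.2.ne
  obtain ⟨b, hb⟩ := pow_unbounded_of_one_lt (I / l) (one_lt_two (α := ℝ))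
  have hbd : ∀ j : ℤ, IsHeavy f l j (cubeIndex j x) → j ≤ b := by
    intro j hj
    by_contra! hlt
    have h1 : ENNReal.ofReal (l * (2 ^ j) ^ n) < ENNReal.ofReal I := by
      rw [hI, ENNReal.ofReal_toReal hIf, ENNReal.ofReal_mul hl.le, ← volume_cube j (cubeIndex j x)]
      exact lt_of_lt_of_le hj (setLIntegral_le_lintegral _ _)
    have h2 := (ENNReal.ofReal_lt_ofReal_iff_of_nonneg (by positivity)).1 h1
    have h3 : (2 : ℝ) ^ b ≤ (2 ^ j) ^ n := by
      have h0 : (0 : ℤ) ≤ b := by positivity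
      calc (2 : ℝ) ^ b ≤ 2 ^ j := by
            rw [← zpow_natCast]; exact zpow_le_zpow_right₀ (by norm_num) hlt.le
        _ ≤ _ := le_self_pow₀ (one_le_zpow₀ (by norm_num) (by omega)) hn
    rw [div_lt_iff₀ hl] at hb
    nlinarith
  obtain ⟨k₀, h0, hmax⟩ := Int.exists_greatest_of_bdd
    (P := fun j => IsHeavy f l j (cubeIndex j x)) ⟨b, hbd⟩ ⟨k, hk⟩
  exact ⟨(k₀, cubeIndex k₀ x), ⟨h0, x, rfl, fun j hj hh => absurd (hmax j hh) (not_le.2 hj)⟩, rfl⟩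

/-- The dyadic parent is not heavy, and its volume is `2 ^ n` times larger. -/
lemma lintegral_stoppingCube_le {f : EuclideanSpace ℝ (Fin n) → 𝕜} {l : ℝ} (hl : 0 < l)
    {i : ℤ × (Fin n → ℤ)} (hi : i ∈ stoppingCubes f l) :
    ∫⁻ z in cube i.1 i.2, ‖f z‖ₑ ≤ ENNReal.ofReal (2 ^ n * l) * volume (cube i.1 i.2) := by
  obtain ⟨-, x, hx, hmax⟩ := hi
  have h1 := hmax (i.1 + 1) (by omega)
  unfold IsHeavy at h1
  push Not at h1
  have hsub : cube i.1 i.2 ⊆ cube (i.1 + 1) (cubeIndex (i.1 + 1) x) := fun z hz =>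
    cubeIndex_eq_of_le (by omega) (hz.trans hx.symm)
  refine (lintegral_mono_set hsub).trans (h1.trans (le_of_eq ?_))
  rw [volume_cube, volume_cube, ← ENNReal.ofReal_mul hl.le, ← ENNReal.ofReal_mul (by positivity),
    zpow_add_one₀ two_ne_zero]
  congr 1
  ring

open Filter Topology in
-- Lebesgue differentiation is available for balls. The cube of side `2 ^ (-j)` through `x` sits in
-- a ball of comparable volume, so the mean of `‖f - f x‖` over the cube is at most a fixed multiple
-- of its mean over the ball, which tends to zero.
lemma ae_norm_le_of_not_isHeavy {f : EuclideanSpace ℝ (Fin n) → 𝕜} (hf : Integrable f) {l : ℝ}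
    (hl : 0 < l) : ∀ᵐ x, (∀ k, ¬ IsHeavy f l k (cubeIndex k x)) → ‖f x‖ ≤ l := by
  filter_upwards [IsUnifLocDoublingMeasure.ae_tendsto_average_norm_sub (μ := volume)
    hf.locallyIntegrable 1] with x hx hlight
  set δ : ℕ → ℝ := fun j => (√n + 1) * 2 ^ (-(j : ℤ)) with hδ
  have hδ0 : ∀ j, 0 < δ j := fun j => by positivity
  have hδlim : Tendsto δ atTop (𝓝[>] 0) := by
    refine tendsto_nhdsWithin_iff.2 ⟨?_, Eventually.of_forall hδ0⟩
    have h1 : Tendsto (fun j : ℕ => ((2 : ℝ)⁻¹) ^ j) atTop (𝓝 0) :=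
      tendsto_pow_atTop_nhds_zero_of_lt_one (by norm_num) (by norm_num)
    simpa [hδ] using h1.const_mul (√n + 1)
  have hav := hx (fun _ : ℕ => x) δ hδlim (Eventually.of_forall fun j => by
    simpa using (hδ0 j).le)
  set V := (volume (Metric.closedBall (0 : EuclideanSpace ℝ (Fin n)) 1)).toReal with hV
  have hmain : ∀ j : ℕ, ‖f x‖ ≤ l + (√n + 1) ^ n * V *
      ⨍ y in Metric.closedBall x (δ j), ‖f y - f x‖ := by
    intro j
    set k : ℤ := -(j : ℤ) with hk
    set Q := cube k (cubeIndex k x) with hQ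
    have hsub : Q ⊆ Metric.closedBall x (δ j) := by
      intro z hz
      have h1 := dist_le_of_mem_cube hz (show x ∈ Q from rfl)
      have h2 : (0 : ℝ) < 2 ^ k := by positivity
      rw [Metric.mem_closedBall]
      simp only [hδ]
      rw [← hk]
      linarith
    have h1 := hlight k
    unfold IsHeavy at h1
    push Not at h1
    have hint : IntegrableOn (fun y => f y - f x) (Metric.closedBall x (δ j)) :=
      hf.integrableOn.sub (integrableOn_const measure_closedBall_lt_top.ne)
    have h2 : ‖f x‖ₑ * volume Q ≤ ENNReal.ofReal l * volume Q +
        ENNReal.ofReal (∫ y in Metric.closedBall x (δ j), ‖f y - f x‖) := by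
      calc ‖f x‖ₑ * volume Q = ∫⁻ _ in Q, ‖f x‖ₑ := by rw [setLIntegral_const]
        _ ≤ ∫⁻ y in Q, (‖f y‖ₑ + ‖f y - f x‖ₑ) := by
            refine lintegral_mono fun y => ?_
            have : f x = f y - (f y - f x) := by ring
            conv_lhs => rw [this]
            exact enorm_sub_le
        _ = (∫⁻ y in Q, ‖f y‖ₑ) + ∫⁻ y in Q, ‖f y - f x‖ₑ :=
            lintegral_add_left' hf.1.restrict.enorm _
        _ ≤ _ := by
            refine add_le_add h1 ?_
            rw [ofReal_integral_norm_eq_lintegral_enorm hint]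
            exact lintegral_mono_set hsub
    have hvQ : volume Q = ENNReal.ofReal (((2 : ℝ) ^ k) ^ n) := volume_cube _ _
    have hv : (0 : ℝ) < ((2 : ℝ) ^ k) ^ n := by positivity
    have h3 : ‖f x‖ * ((2 : ℝ) ^ k) ^ n ≤ l * ((2 : ℝ) ^ k) ^ n +
        ∫ y in Metric.closedBall x (δ j), ‖f y - f x‖ := by
      have h0 : 0 ≤ ∫ y in Metric.closedBall x (δ j), ‖f y - f x‖ :=
        integral_nonneg fun _ => norm_nonneg _
      rw [hvQ, ← ofReal_norm, ← ENNReal.ofReal_mul (norm_nonneg _), ← ENNReal.ofReal_mul hl.le,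
        ← ENNReal.ofReal_add (by positivity) h0] at h2
      exact (ENNReal.ofReal_le_ofReal_iff (by positivity)).1 h2
    have h4 : ∫ y in Metric.closedBall x (δ j), ‖f y - f x‖ =
        ((√n + 1) * 2 ^ k) ^ n * V * ⨍ y in Metric.closedBall x (δ j), ‖f y - f x‖ := by
      have hm : volume.real (Metric.closedBall x (δ j)) = ((√n + 1) * 2 ^ k) ^ n * V := by
        rw [Measure.real, volume_closedBall x (hδ0 j).le, ENNReal.toReal_mul,
          ENNReal.toReal_ofReal (by positivity)]
      rw [← hm, ← smul_eq_mul, measure_smul_setAverage _ measure_closedBall_lt_top.ne]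
    rw [h4, mul_pow] at h3
    refine le_of_mul_le_mul_right (h3.trans (le_of_eq ?_)) hv
    ring
  have hlim : Tendsto (fun j : ℕ => l + (√n + 1) ^ n * V *
      ⨍ y in Metric.closedBall x (δ j), ‖f y - f x‖) atTop (𝓝 (l + (√n + 1) ^ n * V * 0)) :=
    (hav.const_mul _).const_add _
  rw [mul_zero, add_zero] at hlim
  exact ge_of_tendsto' hlim hmain

/-- The union of a family of dyadic cubes. -/
def cubeUnion (S : Set (ℤ × (Fin n → ℤ))) : Set (EuclideanSpace ℝ (Fin n)) :=
  ⋃ i : S, cube i.1.1 i.1.2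

lemma measurableSet_cubeUnion (S : Set (ℤ × (Fin n → ℤ))) : MeasurableSet (cubeUnion S) :=
  MeasurableSet.iUnion fun _ => measurableSet_cube _ _

/-- The Calderón–Zygmund decomposition at height `l`: the good part `g` and the cubes `S`. -/
structure IsCalderonZygmund (f g : EuclideanSpace ℝ (Fin n) → 𝕜) (l : ℝ)
    (S : Set (ℤ × (Fin n → ℤ))) : Prop where
  disjoint : Pairwise (Function.onFun Disjoint fun i : S => cube i.1.1 i.1.2)
  integrable : Integrable g
  norm_le : ∀ᵐ x, ‖g x‖ ≤ 2 ^ n * l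
  lintegral_le : ∫⁻ x, ‖g x‖ₑ ≤ ∫⁻ x, ‖f x‖ₑ
  eq_off : ∀ x, x ∉ cubeUnion S → g x = f x
  setIntegral_eq_zero : ∀ i ∈ S, ∫ x in cube i.1 i.2, (f x - g x) = 0
  mul_volume_le : ∀ i ∈ S, ENNReal.ofReal l * volume (cube i.1 i.2) ≤
    ∫⁻ x in cube i.1 i.2, ‖f x‖ₑ

lemma exists_isCalderonZygmund [Nontrivial (EuclideanSpace ℝ (Fin n))]
    {f : EuclideanSpace ℝ (Fin n) → 𝕜} (hf : Integrable f) {l : ℝ} (hl : 0 < l) :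
    ∃ g S, IsCalderonZygmund f g l S := by
  classical
  set S := stoppingCubes f l with hS
  have hdisj : Pairwise (Function.onFun Disjoint fun i : S => cube i.1.1 i.1.2) :=
    fun i j hij => disjoint_stoppingCubes i.2 j.2 (Subtype.coe_injective.ne hij)
  set a : ℤ × (Fin n → ℤ) → 𝕜 := fun i => ⨍ z in cube i.1 i.2, f z with ha
  -- The good part is the mean of `f` on each stopping cube and `f` elsewhere. Disjointness makes
  -- the chosen cube the only one containing `x`.
  set g : EuclideanSpace ℝ (Fin n) → 𝕜 := fun x =>
    if h : ∃ i ∈ S, x ∈ cube i.1 i.2 then a h.choose else f x with hg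
  have hmeas : ∀ i : S, MeasurableSet (cube i.1.1 i.1.2) := fun i => measurableSet_cube _ _
  have hg_on : ∀ i ∈ S, ∀ x ∈ cube i.1 i.2, g x = a i := by
    intro i hi x hx
    have h : ∃ i ∈ S, x ∈ cube i.1 i.2 := ⟨i, hi, hx⟩
    simp only [hg]
    rw [dif_pos h]
    congr 1
    by_contra hne
    exact Set.disjoint_left.1 (disjoint_stoppingCubes h.choose_spec.1 hi hne) h.choose_spec.2 hx
  have hg_off : ∀ x, x ∉ cubeUnion S → g x = f x := by
    intro x hx
    simp only [hg]
    rw [dif_neg]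
    rintro ⟨i, hi, hxi⟩
    exact hx (mem_iUnion.2 ⟨⟨i, hi⟩, hxi⟩)
  have hvol : ∀ i : ℤ × (Fin n → ℤ), volume (cube i.1 i.2) ≠ ∞ := fun i => by
    rw [volume_cube]; exact ENNReal.ofReal_ne_top
  have hvol0 : ∀ i : ℤ × (Fin n → ℤ), volume (cube i.1 i.2) ≠ 0 := fun i => by
    rw [volume_cube, ENNReal.ofReal_ne_zero_iff]; positivity
  have ha_int : ∀ i, volume.real (cube i.1 i.2) • a i = ∫ z in cube i.1 i.2, f z := fun i =>
    measure_smul_setAverage f (hvol i)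
  have ha_le : ∀ i, ‖a i‖ₑ * volume (cube i.1 i.2) ≤ ∫⁻ z in cube i.1 i.2, ‖f z‖ₑ := by
    intro i
    have h1 := congrArg enorm (ha_int i)
    rw [enorm_smul, Real.enorm_eq_ofReal (by positivity), Measure.real,
      ENNReal.ofReal_toReal (hvol i)] at h1
    rw [mul_comm, h1]
    exact enorm_integral_le_lintegral_enorm _
  have hga : AEStronglyMeasurable g volume := by
    rw [← Measure.restrict_univ (μ := volume), ← union_compl_self (cubeUnion S),
      aestronglyMeasurable_union_iff]
    constructor
    · rw [cubeUnion, aestronglyMeasurable_iUnion_iff]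
      intro i
      refine (aestronglyMeasurable_const (b := a i)).congr ?_
      filter_upwards [ae_restrict_mem (hmeas i)] with x hx
      exact (hg_on i i.2 x hx).symm
    · refine hf.1.restrict.congr ?_
      filter_upwards [ae_restrict_mem (measurableSet_cubeUnion S).compl] with x hx
      exact (hg_off x hx).symm
  have hlint : ∫⁻ x, ‖g x‖ₑ ≤ ∫⁻ x, ‖f x‖ₑ := by
    rw [← lintegral_add_compl _ (measurableSet_cubeUnion S),
      ← lintegral_add_compl (fun x => ‖f x‖ₑ) (measurableSet_cubeUnion S)]
    refine add_le_add ?_ (le_of_eq (setLIntegral_congr_fun (measurableSet_cubeUnion S).compl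
      fun x hx => by rw [hg_off x hx]))
    rw [cubeUnion, lintegral_iUnion hmeas hdisj, lintegral_iUnion hmeas hdisj]
    refine ENNReal.tsum_le_tsum fun i => ?_
    rw [setLIntegral_congr_fun (hmeas i) fun x hx => by rw [hg_on i i.2 x hx], setLIntegral_const]
    exact ha_le i
  refine ⟨g, S, hdisj, ⟨hga, hlint.trans_lt hf.2⟩, ?_, hlint, hg_off, ?_, fun i hi => hi.1.le⟩
  · filter_upwards [ae_norm_le_of_not_isHeavy hf hl] with x hx
    by_cases h : ∃ i ∈ S, x ∈ cube i.1 i.2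
    · obtain ⟨i, hi, hxi⟩ := h
      rw [hg_on i hi x hxi]
      have h1 := (ha_le i).trans (lintegral_stoppingCube_le hl hi)
      rw [ENNReal.mul_le_mul_iff_left (hvol0 i) (hvol i), ← ofReal_norm] at h1
      exact (ENNReal.ofReal_le_ofReal_iff (by positivity)).1 h1
    · have hxu : x ∉ cubeUnion S := fun hx' => by
        obtain ⟨i, hi⟩ := mem_iUnion.1 hx'
        exact h ⟨i, i.2, hi⟩
      rw [hg_off x hxu]
      refine (hx fun k hk => h (exists_mem_stoppingCubes hf hl hk)).trans ?_
      have : (1 : ℝ) ≤ 2 ^ n := one_le_pow₀ (by norm_num)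
      nlinarith
  · intro i hi
    rw [integral_sub hf.integrableOn
        ((integrableOn_const (hvol i) (C := a i)).congr_fun
          (fun x hx => (hg_on i hi x hx).symm) (measurableSet_cube _ _)),
      setIntegral_congr_fun (measurableSet_cube _ _) (hg_on i hi), setIntegral_const, ha_int,
      sub_self]

/-! ### The weak type (1,1) estimate -/

/-- The ball around a dyadic cube outside which the bad part is controlled. -/
def cubeBall (i : ℤ × (Fin n → ℤ)) : Set (EuclideanSpace ℝ (Fin n)) :=
  Metric.closedBall (corner i.1 i.2) ((√n + 1) * 2 ^ i.1)

/-- The constant in the `L¹` estimate for the bad part. -/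
def badConst (n : ℕ) (α : ℝ) : ℝ≥0∞ :=
  ENNReal.ofReal (√n ^ α * (√n + 1) ^ n) *
    volume (Metric.closedBall (0 : EuclideanSpace ℝ (Fin n)) 1) * ∑' d : ℤ, scaleDecay α d

lemma badConst_ne_top (hα : 0 < α) : badConst n α ≠ ∞ :=
  ENNReal.mul_ne_top (ENNReal.mul_ne_top ENNReal.ofReal_ne_top volume_unitBall_ne_top)
    (tsum_scaleDecay_ne_top hα)

/-- Majorant of the contribution of one cube at scale `2 ^ k` to the bad part. -/
def badTerm (α : ℝ) (b : EuclideanSpace ℝ (Fin n) → 𝕜) (k : ℤ) (i : ℤ × (Fin n → ℤ))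
    (x : EuclideanSpace ℝ (Fin n)) : ℝ≥0∞ :=
  if i.1 < k then (Metric.closedBall (corner i.1 i.2) ((√n + 1) * 2 ^ k)).indicator
    (fun _ => ENNReal.ofReal ((((2 : ℝ) ^ k) ^ n)⁻¹ * (√n * 2 ^ i.1 / 2 ^ k) ^ α) *
      ∫⁻ z in cube i.1 i.2, ‖b z‖ₑ) x else 0

lemma measurable_badTerm (b : EuclideanSpace ℝ (Fin n) → 𝕜) (k : ℤ) (i : ℤ × (Fin n → ℤ)) :
    Measurable (badTerm α b k i) := by
  unfold badTerm
  split_ifs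
  · exact measurable_const.indicator measurableSet_closedBall
  · exact measurable_const

/-- The volume of the ball cancels `(2 ^ k) ^ (-n)`; what remains is the decay in `k - i.1`, so each
cube's contributions are summable over scales. -/
lemma lintegral_badTerm_le (b : EuclideanSpace ℝ (Fin n) → 𝕜) (k : ℤ) (i : ℤ × (Fin n → ℤ)) :
    ∫⁻ x, badTerm α b k i x ≤ ENNReal.ofReal (√n ^ α * (√n + 1) ^ n) *
      volume (Metric.closedBall (0 : EuclideanSpace ℝ (Fin n)) 1) * scaleDecay α (k - i.1) *
      ∫⁻ z in cube i.1 i.2, ‖b z‖ₑ := by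
  unfold badTerm
  split_ifs with h
  · rw [lintegral_indicator measurableSet_closedBall, setLIntegral_const,
      volume_closedBall _ (by positivity)]
    have e1 : (√n * 2 ^ i.1 / 2 ^ k : ℝ) = √n * 2 ^ (-|k - i.1|) := by
      rw [abs_of_pos (by linarith), neg_sub, zpow_sub₀ two_ne_zero, mul_div_assoc]
    have e2 : ENNReal.ofReal ((((2 : ℝ) ^ k) ^ n)⁻¹ * (√n * 2 ^ i.1 / 2 ^ k) ^ α) *
        ENNReal.ofReal (((√n + 1) * 2 ^ k) ^ n) =
        ENNReal.ofReal (√n ^ α * (√n + 1) ^ n) * scaleDecay α (k - i.1) := by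
      rw [scaleDecay, ← ENNReal.ofReal_mul (by positivity), ← ENNReal.ofReal_mul (by positivity), e1,
        Real.mul_rpow (by positivity) (by positivity), mul_pow]
      congr 1
      have : (((2 : ℝ) ^ k) ^ n) ≠ 0 := by positivity
      field_simp
    calc _ = (ENNReal.ofReal ((((2 : ℝ) ^ k) ^ n)⁻¹ * (√n * 2 ^ i.1 / 2 ^ k) ^ α) *
        ENNReal.ofReal (((√n + 1) * 2 ^ k) ^ n)) *
        volume (Metric.closedBall (0 : EuclideanSpace ℝ (Fin n)) 1) *
        ∫⁻ z in cube i.1 i.2, ‖b z‖ₑ := by ring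
      _ ≤ _ := by rw [e2]; exact le_of_eq (by ring)
  · simp

/-- Since `x` lies farther than `(√n + 1) 2 ^ i.1` from the corner, a bump of radius `2 ^ k` at `x`
can meet the cube only if `i.1 < k`. Then the mean zero of `b` on the cube gives the gain. -/
lemma enorm_setIntegral_cube_le (hα : 0 < α) {b : EuclideanSpace ℝ (Fin n) → 𝕜}
    (hb : Integrable b) {i : ℤ × (Fin n → ℤ)} (h0 : ∫ z in cube i.1 i.2, b z = 0) {k : ℤ}
    {x : EuclideanSpace ℝ (Fin n)} (hx : x ∉ cubeBall i)
    {ψ : EuclideanSpace ℝ (Fin n) → 𝕜} (hψ : IsBump α x (2 ^ k) ψ) :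
    ‖∫ z in cube i.1 i.2, ψ z * b z‖ₑ ≤ badTerm α b k i x := by
  by_cases hmeet : ∃ z ∈ cube i.1 i.2, z ∈ Metric.closedBall x (2 ^ k)
  · obtain ⟨z, hz, hzx⟩ := hmeet
    have h1 := dist_le_of_mem_cube hz (corner_mem_cube i.1 i.2)
    rw [Metric.mem_closedBall] at hzx
    rw [cubeBall, Metric.mem_closedBall, not_le] at hx
    have h2 := dist_triangle_left x (corner i.1 i.2) z
    have h3 : (2 : ℝ) ^ i.1 < 2 ^ k := by linarith
    have h4 : i.1 < k := (zpow_lt_zpow_iff_right₀ (by norm_num)).1 h3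
    have h5 : x ∈ Metric.closedBall (corner i.1 i.2) ((√n + 1) * 2 ^ k) := by
      rw [Metric.mem_closedBall]
      have : √n * (2 : ℝ) ^ i.1 ≤ √n * 2 ^ k := by gcongr
      linarith
    rw [badTerm, if_pos h4, indicator_of_mem h5]
    exact hψ.enorm_setIntegral_mul_le hα (by positivity) (measurableSet_cube _ _) hb.integrableOn
      h0 fun w hw => dist_le_of_mem_cube hw (corner_mem_cube _ _)
  · have : ∫ z in cube i.1 i.2, ψ z * b z = 0 := by
      refine setIntegral_eq_zero_of_forall_eq_zero fun z hz => ?_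
      rw [hψ.eq_zero z fun hz' => hmeet ⟨z, hz, hz'⟩, zero_mul]
    rw [this]
    simp

lemma bumpSup_le_tsum_badTerm (hα : 0 < α) {b : EuclideanSpace ℝ (Fin n) → 𝕜}
    (hb : Integrable b) {S : Set (ℤ × (Fin n → ℤ))}
    (hS : Pairwise (Function.onFun Disjoint fun i : S => cube i.1.1 i.1.2))
    (hoff : ∀ z, z ∉ cubeUnion S → b z = 0) (h0 : ∀ i ∈ S, ∫ z in cube i.1 i.2, b z = 0)
    {x : EuclideanSpace ℝ (Fin n)} (hx : ∀ i ∈ S, x ∉ cubeBall i) (k : ℤ) :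
    bumpSup α b x (2 ^ k) ≤ ∑' i : S, badTerm α b k i x := by
  refine iSup₂_le fun ψ hψ => ?_
  have hint := hψ.integrable_mul hα hb.locallyIntegrable
  have h1 : ∫ z, ψ z * b z = ∑' i : S, ∫ z in cube i.1.1 i.1.2, ψ z * b z := by
    rw [(hasSum_integral_iUnion (fun i => measurableSet_cube _ _) hS hint.integrableOn).tsum_eq]
    exact (setIntegral_eq_integral_of_forall_compl_eq_zero fun z hz => by
      rw [hoff z hz, mul_zero]).symm
  rw [h1]
  refine enorm_tsum_le_tsum_enorm.trans (ENNReal.tsum_le_tsum fun i => ?_)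
  exact enorm_setIntegral_cube_le hα hb (h0 i i.2) (hx i i.2) hψ

lemma lintegral_tsum_badTerm_le {b : EuclideanSpace ℝ (Fin n) → 𝕜}
    {S : Set (ℤ × (Fin n → ℤ))}
    (hS : Pairwise (Function.onFun Disjoint fun i : S => cube i.1.1 i.1.2)) :
    ∫⁻ x, ∑' k : ℤ, ∑' i : S, badTerm α b k i x ≤ badConst n α * ∫⁻ z, ‖b z‖ₑ := by
  rw [lintegral_tsum fun k =>
    (Measurable.tsum fun i : S => measurable_badTerm b k i.1).aemeasurable]
  have h1 : ∀ k, ∫⁻ x, ∑' i : S, badTerm α b k i x = ∑' i : S, ∫⁻ x, badTerm α b k i x := fun k =>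
    lintegral_tsum fun i : S => (measurable_badTerm (α := α) b k i.1).aemeasurable
  simp_rw [h1]
  rw [ENNReal.tsum_comm]
  calc ∑' i : S, ∑' k : ℤ, ∫⁻ x, badTerm α b k i x
      ≤ ∑' i : S, badConst n α * ∫⁻ z in cube i.1.1 i.1.2, ‖b z‖ₑ := by
        refine ENNReal.tsum_le_tsum fun i => ?_
        refine (ENNReal.tsum_le_tsum fun k => lintegral_badTerm_le b k i.1).trans (le_of_eq ?_)
        have hshift : ∑' k : ℤ, scaleDecay α (k - i.1.1) = ∑' d : ℤ, scaleDecay α d :=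
          (Equiv.subRight i.1.1).tsum_eq (scaleDecay α)
        rw [ENNReal.tsum_mul_right, ENNReal.tsum_mul_left, hshift, badConst]
    _ ≤ _ := by
        rw [ENNReal.tsum_mul_left,
          ← lintegral_iUnion (fun i : S => measurableSet_cube i.1.1 i.1.2) hS]
        gcongr
        exact Measure.restrict_le_self

/-- The constant in the weak type (1,1) estimate. -/
def weakConst (n : ℕ) (α : ℝ) : ℝ≥0∞ :=
  16 * schurConst n α * 2 ^ n +
    ENNReal.ofReal ((√n + 1) ^ n) * volume (Metric.closedBall (0 : EuclideanSpace ℝ (Fin n)) 1) +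
    4 * badConst n α

lemma weakConst_ne_top (hα : 0 < α) : weakConst n α ≠ ∞ := by
  have h1 := schurConst_ne_top (n := n) hα
  have h2 := badConst_ne_top (n := n) hα
  have h3 := volume_unitBall_ne_top (n := n)
  unfold weakConst
  finiteness

lemma IsCalderonZygmund.lintegral_sq_le {f g : EuclideanSpace ℝ (Fin n) → 𝕜} {l : ℝ}
    {S : Set (ℤ × (Fin n → ℤ))} (h : IsCalderonZygmund f g l S) :
    ∫⁻ x, ‖g x‖ₑ ^ 2 ≤ ENNReal.ofReal (2 ^ n * l) * ∫⁻ x, ‖f x‖ₑ := by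
  refine le_trans ?_ (mul_le_mul_right h.lintegral_le _)
  rw [← lintegral_const_mul' _ _ ENNReal.ofReal_ne_top]
  refine lintegral_mono_ae ?_
  filter_upwards [h.norm_le] with x hx
  rw [sq]
  gcongr
  rw [← ofReal_norm]
  exact ENNReal.ofReal_le_ofReal hx

lemma IsCalderonZygmund.memLp_two {f g : EuclideanSpace ℝ (Fin n) → 𝕜} {l : ℝ}
    {S : Set (ℤ × (Fin n → ℤ))} (h : IsCalderonZygmund f g l S) : MemLp g 2 := by
  rw [memLp_two_iff_integrable_sq_norm h.integrable.1]
  simp_rw [sq]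
  exact h.integrable.norm.bdd_mul h.integrable.1.norm (c := 2 ^ n * l) (by simpa using h.norm_le)

/-- Each enlarged ball has volume a fixed multiple of that of its cube, and the disjoint cubes have
mean of `‖f‖` at least `l`. -/
lemma IsCalderonZygmund.mul_volume_cubeBalls_le {f g : EuclideanSpace ℝ (Fin n) → 𝕜} {l : ℝ}
    {S : Set (ℤ × (Fin n → ℤ))} (h : IsCalderonZygmund f g l S) :
    ENNReal.ofReal l * volume (⋃ i : S, cubeBall i.1) ≤ ENNReal.ofReal ((√n + 1) ^ n) *
      volume (Metric.closedBall (0 : EuclideanSpace ℝ (Fin n)) 1) * ∫⁻ x, ‖f x‖ₑ := by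
  calc ENNReal.ofReal l * volume (⋃ i : S, cubeBall i.1)
      ≤ ENNReal.ofReal l * ∑' i : S, volume (cubeBall i.1) := by
        gcongr
        exact measure_iUnion_le _
    _ = ENNReal.ofReal ((√n + 1) ^ n) *
        volume (Metric.closedBall (0 : EuclideanSpace ℝ (Fin n)) 1) *
          ∑' i : S, ENNReal.ofReal l * volume (cube i.1.1 i.1.2) := by
        rw [← ENNReal.tsum_mul_left, ← ENNReal.tsum_mul_left]
        refine tsum_congr fun i => ?_
        rw [cubeBall, volume_closedBall (corner i.1.1 i.1.2) (by positivity), volume_cube, mul_pow,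
          ENNReal.ofReal_mul (by positivity)]
        ring
    _ ≤ _ := by
        gcongr
        refine (ENNReal.tsum_le_tsum fun i : S => h.mul_volume_le i i.2).trans ?_
        rw [← lintegral_iUnion (fun i : S => measurableSet_cube i.1.1 i.1.2) h.disjoint]
        exact setLIntegral_le_lintegral _ _

/-- `g_α` is of weak type (1,1). -/
lemma mul_volume_discreteG_le [Nontrivial (EuclideanSpace ℝ (Fin n))]
    (hα : 0 < α) (hα1 : α ≤ 1) {f : EuclideanSpace ℝ (Fin n) → 𝕜} (hf : Integrable f) {l : ℝ}
    (hl : 0 < l) :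
    ENNReal.ofReal l * volume {x | ENNReal.ofReal l ^ 2 < discreteG α f x} ≤
      weakConst n α * ∫⁻ x, ‖f x‖ₑ := by
  obtain ⟨g, S, h⟩ := exists_isCalderonZygmund hf hl
  obtain ⟨H, hHm, hH, hHi⟩ := lintegral_discreteG_le hα hα1 h.memLp_two
  set b : EuclideanSpace ℝ (Fin n) → 𝕜 := fun x => f x - g x with hb
  have hbi : Integrable b := hf.sub h.integrable
  set K : EuclideanSpace ℝ (Fin n) → ℝ≥0∞ := fun x => ∑' k : ℤ, ∑' i : S, badTerm α b k i x with hK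
  have hKm : Measurable K :=
    Measurable.tsum fun k => Measurable.tsum fun i => measurable_badTerm b k i.1
  have hKi : ∫⁻ x, K x ≤ badConst n α * (2 * ∫⁻ x, ‖f x‖ₑ) := by
    refine (lintegral_tsum_badTerm_le h.disjoint).trans ?_
    gcongr
    calc ∫⁻ z, ‖b z‖ₑ ≤ ∫⁻ z, (‖f z‖ₑ + ‖g z‖ₑ) := lintegral_mono fun z => enorm_sub_le
      _ = (∫⁻ z, ‖f z‖ₑ) + ∫⁻ z, ‖g z‖ₑ := lintegral_add_left' hf.1.enorm _
      _ ≤ _ := by rw [two_mul]; exact add_le_add le_rfl h.lintegral_le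
  -- The thresholds fit `(a + b) ^ 2 ≤ 2 a ^ 2 + 2 b ^ 2`: the good part gives at most `l ^ 2 / 4`,
  -- and so does the bad part, as `(l / 2) ^ 2`; twice each adds up to `l ^ 2`.
  have hsub : {x | ENNReal.ofReal l ^ 2 < discreteG α f x} ⊆
      {x | ENNReal.ofReal (l ^ 2 / 4) ≤ H x} ∪ (⋃ i : S, cubeBall i.1) ∪
        {x | ENNReal.ofReal (l / 2) ≤ K x} := by
    intro x hx
    by_contra hnot
    simp only [mem_union, mem_ofPred_eq, not_or, not_le, mem_iUnion, not_exists] at hnot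
    obtain ⟨⟨h1, h2⟩, h3⟩ := hnot
    have hbK : discreteG α b x ≤ ENNReal.ofReal (l ^ 2 / 4) := by
      refine (tsum_sq_le_sq_tsum _).trans ?_
      have h4 : ∑' k : ℤ, bumpSup α b x (2 ^ k) ≤ ENNReal.ofReal (l / 2) := by
        refine le_trans (ENNReal.tsum_le_tsum fun k => ?_) h3.le
        refine bumpSup_le_tsum_badTerm hα hbi h.disjoint (fun z hz => ?_) h.setIntegral_eq_zero
          (fun i hi => h2 ⟨i, hi⟩) k
        rw [hb]
        simp [h.eq_off z hz]
      refine (pow_le_pow_left' h4 2).trans (le_of_eq ?_)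
      rw [← ENNReal.ofReal_pow (by positivity)]
      congr 1
      ring
    have hfgb : f = fun x => g x + b x := by
      funext z
      simp [hb]
    have h5 := discreteG_add_le hα h.integrable.locallyIntegrable hbi.locallyIntegrable x
    rw [← hfgb] at h5
    have h6 : discreteG α f x ≤ ENNReal.ofReal l ^ 2 := by
      refine h5.trans ((add_le_add (mul_le_mul_right ((hH x).trans h1.le) 2)
        (mul_le_mul_right hbK 2)).trans (le_of_eq ?_))
      rw [← mul_add, ← ENNReal.ofReal_add (by positivity) (by positivity),
        ← ENNReal.ofReal_pow hl.le, show (2 : ℝ≥0∞) = ENNReal.ofReal 2 by norm_num,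
        ← ENNReal.ofReal_mul (by norm_num)]
      congr 1
      ring
    exact absurd hx (not_lt.2 h6)
  have e1 : ENNReal.ofReal l * volume {x | ENNReal.ofReal (l ^ 2 / 4) ≤ H x} ≤
      16 * schurConst n α * 2 ^ n * ∫⁻ x, ‖f x‖ₑ := by
    have e0 : ENNReal.ofReal l = ENNReal.ofReal (4 / l) * ENNReal.ofReal (l ^ 2 / 4) := by
      rw [← ENNReal.ofReal_mul (by positivity)]
      congr 1
      field_simp
    have e3 : ENNReal.ofReal (4 / l) * ENNReal.ofReal (2 ^ n * l) = 4 * 2 ^ n := by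
      rw [← ENNReal.ofReal_mul (by positivity),
        show 4 / l * (2 ^ n * l) = 4 * 2 ^ n by field_simp, ENNReal.ofReal_mul (by norm_num),
        ENNReal.ofReal_pow (by norm_num)]
      norm_num
    calc _ = ENNReal.ofReal (4 / l) *
          (ENNReal.ofReal (l ^ 2 / 4) * volume {x | ENNReal.ofReal (l ^ 2 / 4) ≤ H x}) := by
          rw [e0, mul_assoc]
      _ ≤ ENNReal.ofReal (4 / l) * (4 * schurConst n α *
            (ENNReal.ofReal (2 ^ n * l) * ∫⁻ x, ‖f x‖ₑ)) := by
          refine mul_le_mul_right ?_ _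
          exact (mul_meas_ge_le_lintegral hHm _).trans
            (hHi.trans (mul_le_mul_right h.lintegral_sq_le _))
      _ = (ENNReal.ofReal (4 / l) * ENNReal.ofReal (2 ^ n * l)) * (4 * schurConst n α) *
            ∫⁻ x, ‖f x‖ₑ := by ring
      _ ≤ _ := by rw [e3]; exact le_of_eq (by ring)
  have e2 : ENNReal.ofReal l * volume {x | ENNReal.ofReal (l / 2) ≤ K x} ≤
      4 * badConst n α * ∫⁻ x, ‖f x‖ₑ := by
    have e0 : ENNReal.ofReal l = 2 * ENNReal.ofReal (l / 2) := by
      rw [show (2 : ℝ≥0∞) = ENNReal.ofReal 2 by norm_num, ← ENNReal.ofReal_mul (by norm_num)]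
      congr 1
      ring
    calc _ = 2 * (ENNReal.ofReal (l / 2) * volume {x | ENNReal.ofReal (l / 2) ≤ K x}) := by
          rw [e0, mul_assoc]
      _ ≤ 2 * (badConst n α * (2 * ∫⁻ x, ‖f x‖ₑ)) := by
          refine mul_le_mul_right ?_ _
          exact (mul_meas_ge_le_lintegral hKm _).trans hKi
      _ = _ := by ring
  calc _ ≤ ENNReal.ofReal l * (volume {x | ENNReal.ofReal (l ^ 2 / 4) ≤ H x} +
        volume (⋃ i : S, cubeBall i.1) + volume {x | ENNReal.ofReal (l / 2) ≤ K x}) := by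
        gcongr
        refine (measure_mono hsub).trans ((measure_union_le _ _).trans ?_)
        gcongr
        exact measure_union_le _ _
    _ ≤ _ := by
        rw [mul_add, mul_add, weakConst, add_mul, add_mul]
        exact add_le_add (add_le_add e1 h.mul_volume_cubeBalls_le) e2

/-! ### Comparison of `g_α` with its discrete majorant -/

/-- Replacing `t` by `T ≤ 2 t` costs `2 ^ n` in the normalisation and `2 ^ α ≤ 2` in the Hölder
bound, hence the factor `2 ^ (n + 1)`. -/
lemma IsKernel.isBump (hα : 0 < α) (hα1 : α ≤ 1) {φ : EuclideanSpace ℝ (Fin n) → 𝕜}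
    (hφ : IsKernel α φ) (x : EuclideanSpace ℝ (Fin n)) {t T : ℝ} (ht : 0 < t) (htT : t ≤ T)
    (hTt : T ≤ 2 * t) :
    IsBump α x T fun z => ((2 : ℝ) ^ (n + 1))⁻¹ • dilate t φ (x - z) where
  eq_zero z hz := by
    have : φ (t⁻¹ • (x - z)) = 0 := by
      by_contra hne
      have h1 := hφ.support_subset (Function.mem_support.2 hne)
      rw [mem_closedBall_zero_iff, norm_smul, norm_inv, Real.norm_of_nonneg ht.le,
        inv_mul_le_iff₀ ht, mul_one, ← dist_eq_norm, dist_comm] at h1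
      exact hz (Metric.mem_closedBall.2 (h1.trans htT))
    simp [dilate, this]
  integral_eq_zero := by
    have h1 : ∫ z, dilate t φ (x - z) = ∫ z, dilate t φ z :=
      integral_sub_left_eq_self (dilate t φ) volume x
    rw [integral_smul, h1]
    simp only [dilate]
    rw [integral_smul, Measure.integral_comp_smul, hφ.integral_eq_zero]
    simp
  holder z z' := by
    have hT : 0 < T := ht.trans_le htT
    rw [← smul_sub, norm_smul, dilate, dilate, ← smul_sub, norm_smul, norm_inv, norm_inv,
      Real.norm_of_nonneg (by positivity), Real.norm_of_nonneg (by positivity)]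
    have h1 : ‖φ (t⁻¹ • (x - z)) - φ (t⁻¹ • (x - z'))‖ ≤ 2 * (‖z - z'‖ / T) ^ α := by
      refine (hφ.holder _ _).trans ?_
      rw [← smul_sub, sub_sub_sub_cancel_left, norm_smul, norm_inv, Real.norm_of_nonneg ht.le,
        norm_sub_rev]
      calc (t⁻¹ * ‖z - z'‖) ^ α ≤ (2 * (‖z - z'‖ / T)) ^ α := by
            refine Real.rpow_le_rpow (by positivity) ?_ hα.le
            rw [inv_mul_le_iff₀ ht, mul_comm t, mul_assoc, div_mul_eq_mul_div, ← mul_div_assoc,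
              le_div_iff₀ hT]
            nlinarith [norm_nonneg (z - z')]
        _ = 2 ^ α * (‖z - z'‖ / T) ^ α := Real.mul_rpow (by norm_num) (by positivity)
        _ ≤ 2 * (‖z - z'‖ / T) ^ α := by
            gcongr
            simpa using Real.rpow_le_rpow_of_exponent_le (show (1 : ℝ) ≤ 2 by norm_num) hα1
    have h2 : (t ^ n)⁻¹ ≤ 2 ^ n * (T ^ n)⁻¹ := by
      rw [inv_le_comm₀ (by positivity) (by positivity), mul_inv, inv_inv, inv_mul_le_iff₀ (by positivity),
        ← mul_pow]
      gcongr
    calc _ ≤ ((2 : ℝ) ^ (n + 1))⁻¹ * (2 ^ n * (T ^ n)⁻¹ * (2 * (‖z - z'‖ / T) ^ α)) := by gcongr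
      _ = _ := by
        rw [pow_succ]
        field_simp

lemma intrinsicA_le (hα : 0 < α) (hα1 : α ≤ 1) (f : EuclideanSpace ℝ (Fin n) → 𝕜)
    (x : EuclideanSpace ℝ (Fin n)) {t T : ℝ} (ht : 0 < t) (htT : t ≤ T) (hTt : T ≤ 2 * t) :
    intrinsicA α f x t ≤ 2 ^ (n + 1) * bumpSup α f x T := by
  refine iSup₂_le fun φ hφ => ?_
  have hψ := hφ.isBump hα hα1 x ht htT hTt
  have h1 := le_iSup₂ (f := fun ψ (_ : IsBump α x T ψ) => ‖∫ z, ψ z * f z‖ₑ) _ hψ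
  have h2 : ∫ z, ((2 : ℝ) ^ (n + 1))⁻¹ • dilate t φ (x - z) * f z =
      ((2 : ℝ) ^ (n + 1))⁻¹ • ∫ z, dilate t φ (x - z) * f z := by
    simp_rw [smul_mul_assoc]
    rw [integral_smul]
  have h3 : ‖∫ z, dilate t φ (x - z) * f z‖ₑ =
      2 ^ (n + 1) * ‖∫ z, ((2 : ℝ) ^ (n + 1))⁻¹ • dilate t φ (x - z) * f z‖ₑ := by
    rw [h2, enorm_smul, ← mul_assoc, Real.enorm_of_nonneg (by positivity),
      show (2 : ℝ≥0∞) ^ (n + 1) = ENNReal.ofReal (2 ^ (n + 1)) by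
        rw [ENNReal.ofReal_pow (by norm_num)]; norm_num,
      ← ENNReal.ofReal_mul (by positivity), mul_inv_cancel₀ (by positivity), ENNReal.ofReal_one,
      one_mul]
  rw [h3]
  exact mul_le_mul_right h1 _

lemma intrinsicG_sq_le (hα : 0 < α) (hα1 : α ≤ 1) (f : EuclideanSpace ℝ (Fin n) → 𝕜)
    (x : EuclideanSpace ℝ (Fin n)) :
    intrinsicG α f x ^ 2 ≤ (2 ^ (n + 1)) ^ 2 * discreteG α f x := by
  rw [intrinsicG, ← ENNReal.rpow_natCast, ← ENNReal.rpow_mul]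
  norm_num only [Nat.cast_ofNat, one_div, ENNReal.rpow_one]
  have hcover : Ioi (0 : ℝ) ⊆ ⋃ k : ℤ, Ioc ((2 : ℝ) ^ k) (2 ^ (k + 1)) := fun t ht =>
    mem_iUnion.2 (exists_mem_Ioc_zpow ht one_lt_two)
  refine (lintegral_mono_set hcover).trans ((lintegral_iUnion_le _ _).trans ?_)
  have hshift : ∑' k : ℤ, bumpSup α f x (2 ^ (k + 1)) ^ 2 = discreteG α f x :=
    (Equiv.addRight (1 : ℤ)).tsum_eq fun k : ℤ => bumpSup α f x (2 ^ k) ^ 2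
  rw [← hshift, ← ENNReal.tsum_mul_left]
  refine ENNReal.tsum_le_tsum fun k => ?_
  have hk : (0 : ℝ) < 2 ^ k := by positivity
  have hk1 : (2 : ℝ) ^ (k + 1) = 2 * 2 ^ k := by rw [zpow_add_one₀ two_ne_zero, mul_comm]
  -- On this interval `1 / t ≤ 2 ^ (-k)` and the length is `2 ^ k`, so `dt / t` contributes at most
  -- `1`.
  calc ∫⁻ t in Ioc ((2 : ℝ) ^ k) (2 ^ (k + 1)), intrinsicA α f x t ^ 2 / ENNReal.ofReal t
      ≤ ∫⁻ _ in Ioc ((2 : ℝ) ^ k) (2 ^ (k + 1)),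
          (2 ^ (n + 1) * bumpSup α f x (2 ^ (k + 1))) ^ 2 / ENNReal.ofReal (2 ^ k) := by
        refine setLIntegral_mono' measurableSet_Ioc fun t ht => ?_
        refine ENNReal.div_le_div (pow_le_pow_left' ?_ 2) (ENNReal.ofReal_le_ofReal ht.1.le)
        exact intrinsicA_le hα hα1 f x (hk.trans ht.1) ht.2 (by linarith [ht.1])
    _ = (2 ^ (n + 1) * bumpSup α f x (2 ^ (k + 1))) ^ 2 := by
        rw [setLIntegral_const, Real.volume_Ioc, hk1, two_mul, add_sub_cancel_right,
          ENNReal.div_mul_cancel (by simpa using hk) ENNReal.ofReal_ne_top]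
    _ = _ := by rw [mul_pow]

/-! ### The local estimate in Morrey spaces -/

lemma IsGrowthFunction.two_pow_mul_le {Φ : ℝ → ℝ} {D : ℝ} (hΦ : IsGrowthFunction Φ D) {r : ℝ}
    (hr : 0 < r) (i : ℕ) : Φ (2 ^ i * r) ≤ D ^ i * Φ r := by
  induction i with
  | zero => simp
  | succ i ih =>
    have h1 := hΦ.doubling (2 ^ i * r) (by positivity)
    have h0 := hΦ.one_le
    rw [← mul_assoc, mul_comm 2, ← pow_succ] at h1
    calc _ ≤ D * Φ (2 ^ i * r) := h1
      _ ≤ D * (D ^ i * Φ r) := by gcongr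
      _ = _ := by ring

/-- The infimum defining the norm is attained, because one may divide by the positive number `Φ r`.
-/
lemma lintegral_ball_le_morreyNorm {Φ : ℝ → ℝ} (hpos : ∀ r, 0 < r → 0 < Φ r)
    (f : EuclideanSpace ℝ (Fin n) → 𝕜) (x₀ : EuclideanSpace ℝ (Fin n)) {r : ℝ} (hr : 0 < r) :
    ∫⁻ x in Metric.ball x₀ r, ‖f x‖ₑ ≤ morreyNorm Φ f * ENNReal.ofReal (Φ r) := by
  have h0 : ENNReal.ofReal (Φ r) ≠ 0 := by simpa using hpos r hr
  rw [← ENNReal.div_le_iff h0 ENNReal.ofReal_ne_top]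
  refine le_sInf fun C hC => ?_
  rw [ENNReal.div_le_iff h0 ENNReal.ofReal_ne_top]
  exact hC x₀ r hr

/-- The constant in the estimate for the part of the function away from the ball. -/
def tailConst (n : ℕ) (D : ℝ) : ℝ≥0∞ := ENNReal.ofReal (3 * D ^ 2) * (1 - ENNReal.ofReal (D / 2 ^ n))⁻¹

lemma tailConst_ne_top {D : ℝ} (hD : D < 2 ^ n) : tailConst n D ≠ ∞ := by
  refine ENNReal.mul_ne_top ENNReal.ofReal_ne_top (ENNReal.inv_ne_top.2 ?_)
  rw [Ne, tsub_eq_zero_iff_le, not_le, ENNReal.ofReal_lt_one, div_lt_one (by positivity)]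
  exact hD

lemma discreteG_indicator_compl_le [Nontrivial (EuclideanSpace ℝ (Fin n))] (hα1 : α ≤ 1)
    {Φ : ℝ → ℝ} {D : ℝ} (hΦ : IsGrowthFunction Φ D) (f : EuclideanSpace ℝ (Fin n) → 𝕜)
    {x₀ x : EuclideanSpace ℝ (Fin n)} {r : ℝ} (hx : x ∈ Metric.ball x₀ r) :
    discreteG α ((Metric.ball x₀ (2 * r))ᶜ.indicator f) x ≤
      (tailConst n D * (morreyNorm Φ f * ENNReal.ofReal ((r ^ n)⁻¹ * Φ r))) ^ 2 := by
  have hr : 0 < r := Metric.pos_of_mem_ball hx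
  have hD0 : 0 < D := by linarith [hΦ.one_le]
  refine (tsum_sq_le_sq_tsum _).trans (pow_le_pow_left' ?_ 2)
  set f₂ := (Metric.ball x₀ (2 * r))ᶜ.indicator f with hf₂
  -- Here `2 ^ j < r ≤ 2 ^ (j + 1)`. Bumps of radius at most `2 ^ j` centred in the ball stay inside
  -- the doubled ball; the remaining scales are `j + 1 + i` with `i ≥ 0`.
  obtain ⟨j, hj1, hj2⟩ := exists_mem_Ioc_zpow hr one_lt_two
  have hzero : ∀ k : ℤ, k ≤ j → bumpSup α f₂ x (2 ^ k) = 0 := by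
    intro k hk
    have hkr : (2 : ℝ) ^ k < r := (zpow_le_zpow_right₀ (by norm_num) hk).trans_lt hj1
    refine le_antisymm (iSup₂_le fun ψ hψ => ?_) zero_le
    have : ∀ z, ψ z * f₂ z = 0 := by
      intro z
      by_cases hz : z ∈ Metric.closedBall x (2 ^ k)
      · rw [Metric.mem_closedBall] at hz
        rw [Metric.mem_ball] at hx
        have : z ∈ Metric.ball x₀ (2 * r) := by
          rw [Metric.mem_ball]
          linarith [dist_triangle z x x₀]
        rw [hf₂, indicator_of_notMem (notMem_compl_iff.2 this), mul_zero]
      · rw [hψ.eq_zero z hz, zero_mul]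
    simp [this]
  have hinj : Function.Injective fun i : ℕ => j + 1 + (i : ℤ) := fun a b h => by simpa using h
  rw [← hinj.tsum_eq]
  · have hterm : ∀ i : ℕ, bumpSup α f₂ x (2 ^ (j + 1 + (i : ℤ))) ≤
        ENNReal.ofReal (3 * D ^ 2) * (morreyNorm Φ f * ENNReal.ofReal ((r ^ n)⁻¹ * Φ r)) *
          ENNReal.ofReal (D / 2 ^ n) ^ i := by
      intro i
      set T : ℝ := 2 ^ (j + 1 + (i : ℤ)) with hT
      have hT0 : 0 < T := by positivity
      have hTr : 2 ^ i * r ≤ T := by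
        rw [hT, zpow_add₀ two_ne_zero, zpow_natCast, mul_comm]
        gcongr
      -- The closed ball of radius `T` is enclosed in the open ball of radius `2 T ≤ 2 ^ (i + 2) r`;
      -- the two extra doublings give the `D ^ 2` in `tailConst`.
      have hTr2 : 2 * T ≤ 2 ^ (i + 2) * r := by
        rw [hT, zpow_add₀ two_ne_zero, zpow_natCast, zpow_add_one₀ two_ne_zero, pow_add]
        nlinarith [show (0 : ℝ) < 2 ^ i by positivity]
      have h1 : ∫⁻ z in Metric.closedBall x T, ‖f₂ z‖ₑ ≤
          morreyNorm Φ f * ENNReal.ofReal (D ^ (i + 2) * Φ r) := by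
        calc _ ≤ ∫⁻ z in Metric.ball x (2 * T), ‖f z‖ₑ := by
              refine (lintegral_mono_set (Metric.closedBall_subset_ball (by linarith))).trans
                (lintegral_mono fun z => ?_)
              exact enorm_indicator_le_enorm_self f z
          _ ≤ morreyNorm Φ f * ENNReal.ofReal (Φ (2 * T)) :=
              lintegral_ball_le_morreyNorm hΦ.pos f x (by positivity)
          _ ≤ _ := by
              gcongr
              exact (hΦ.mono (mem_Ioi.2 (by positivity)) (mem_Ioi.2 (by positivity)) hTr2).trans
                (hΦ.two_pow_mul_le hr _)
      have h2 : (T ^ n)⁻¹ ≤ (r ^ n)⁻¹ * ((2 ^ n)⁻¹) ^ i := by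
        rw [← inv_pow, ← inv_pow, ← inv_pow, ← pow_mul, mul_comm n i, pow_mul, ← mul_pow]
        refine pow_le_pow_left₀ (by positivity) ?_ n
        rw [inv_pow, ← mul_inv, mul_comm r]
        exact inv_anti₀ (by positivity) hTr
      have h3 : (0 : ℝ) < Φ r := hΦ.pos r hr
      refine iSup₂_le fun ψ hψ => (hψ.enorm_integral_mul_le hα1 hT0 f₂).trans ?_
      calc _ ≤ ENNReal.ofReal (3 * ((r ^ n)⁻¹ * ((2 ^ n)⁻¹) ^ i)) *
            (morreyNorm Φ f * ENNReal.ofReal (D ^ (i + 2) * Φ r)) := by gcongr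
        _ = morreyNorm Φ f * ENNReal.ofReal
            (3 * ((r ^ n)⁻¹ * ((2 ^ n)⁻¹) ^ i) * (D ^ (i + 2) * Φ r)) := by
            rw [ENNReal.ofReal_mul (p := 3 * ((r ^ n)⁻¹ * ((2 ^ n)⁻¹) ^ i)) (by positivity)]
            ring
        _ = morreyNorm Φ f * ENNReal.ofReal
            (3 * D ^ 2 * ((r ^ n)⁻¹ * Φ r) * (D / 2 ^ n) ^ i) := by
            congr 2
            rw [div_eq_mul_inv, mul_pow, pow_add]
            ring
        _ = _ := by
            rw [ENNReal.ofReal_mul (by positivity), ENNReal.ofReal_mul (by positivity),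
              ENNReal.ofReal_pow (by positivity)]
            ring
    refine (ENNReal.tsum_le_tsum hterm).trans (le_of_eq ?_)
    rw [ENNReal.tsum_mul_left, ENNReal.tsum_geometric, tailConst]
    ring
  · intro k hk
    rw [Function.mem_support] at hk
    have hjk : j < k := by
      by_contra! h
      exact hk (hzero k h)
    exact ⟨(k - (j + 1)).toNat, by simp only; omega⟩

/-- The constant in the weak Morrey estimate. -/
def morreyConst (n : ℕ) (α D : ℝ) : ℝ≥0∞ :=
  2 ^ (n + 2) * (weakConst n α * ENNReal.ofReal D +
    tailConst n D * volume (Metric.closedBall (0 : EuclideanSpace ℝ (Fin n)) 1))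

lemma morreyConst_ne_top (hα : 0 < α) {D : ℝ} (hD : D < 2 ^ n) : morreyConst n α D ≠ ∞ := by
  have h1 := weakConst_ne_top (n := n) hα
  have h2 := tailConst_ne_top hD
  have h3 := volume_unitBall_ne_top (n := n)
  unfold morreyConst
  finiteness

lemma mul_volume_intrinsicG_le [Nontrivial (EuclideanSpace ℝ (Fin n))] (hα : 0 < α) (hα1 : α ≤ 1)
    {Φ : ℝ → ℝ} {D : ℝ} (hΦ : IsGrowthFunction Φ D) {f : EuclideanSpace ℝ (Fin n) → 𝕜}
    (hf : LocallyIntegrable f) (x₀ : EuclideanSpace ℝ (Fin n)) {r s : ℝ} (hr : 0 < r)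
    (hs : 0 < s) :
    ENNReal.ofReal s *
        volume {x | x ∈ Metric.ball x₀ r ∧ ENNReal.ofReal s < intrinsicG α f x} ≤
      morreyConst n α D * morreyNorm Φ f * ENNReal.ofReal (Φ r) := by
  set B := Metric.ball x₀ (2 * r) with hB
  have hBm : MeasurableSet B := Metric.isOpen_ball.measurableSet
  set f₁ := B.indicator f with hf₁
  set f₂ := Bᶜ.indicator f with hf₂
  have hfB : IntegrableOn f B :=
    (hf.integrableOn_isCompact (isCompact_closedBall x₀ (2 * r))).mono_set
      Metric.ball_subset_closedBall
  have hi₁ : Integrable f₁ := hfB.integrable_indicator hBm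
  have hi₂ : LocallyIntegrable f₂ := hf.indicator hBm.compl
  have hsum : f = fun x => f₁ x + f₂ x := by
    funext x
    exact (congrFun (indicator_self_add_compl B f) x).symm
  -- Chosen so that `(2 ^ (n + 1)) ^ 2 * (2 c ^ 2 + 2 c ^ 2) = s ^ 2`.
  set c : ℝ := s / 2 ^ (n + 2) with hc
  have hc0 : 0 < c := by positivity
  have hcs : ENNReal.ofReal s = 2 ^ (n + 2) * ENNReal.ofReal c := by
    rw [show (2 : ℝ≥0∞) ^ (n + 2) = ENNReal.ofReal (2 ^ (n + 2)) by
        rw [ENNReal.ofReal_pow (by norm_num)]; norm_num, ← ENNReal.ofReal_mul (by positivity), hc,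
      mul_div_cancel₀ _ (by positivity)]
  have hsub : {x | x ∈ Metric.ball x₀ r ∧ ENNReal.ofReal s < intrinsicG α f x} ⊆
      {x | ENNReal.ofReal c ^ 2 < discreteG α f₁ x} ∪
        {x | x ∈ Metric.ball x₀ r ∧ ENNReal.ofReal c ^ 2 < discreteG α f₂ x} := by
    rintro x ⟨hxB, hx⟩
    by_contra hnot
    simp only [mem_union, mem_ofPred_eq, not_or, not_and, not_lt] at hnot
    obtain ⟨h1, h2⟩ := hnot
    have h3 := discreteG_add_le hα hi₁.locallyIntegrable hi₂ x
    rw [← hsum] at h3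
    have h4 : intrinsicG α f x ^ 2 ≤ ENNReal.ofReal s ^ 2 := by
      refine (intrinsicG_sq_le hα hα1 f x).trans ?_
      calc _ ≤ (2 ^ (n + 1)) ^ 2 * (2 * ENNReal.ofReal c ^ 2 + 2 * ENNReal.ofReal c ^ 2) := by
            refine mul_le_mul_right (h3.trans ?_) _
            exact add_le_add (mul_le_mul_right h1 2) (mul_le_mul_right (h2 hxB) 2)
        _ = _ := by rw [hcs]; ring
    exact absurd (ENNReal.pow_lt_pow_left two_ne_zero hx) (not_lt.2 h4)
  have e1 : ENNReal.ofReal c * volume {x | ENNReal.ofReal c ^ 2 < discreteG α f₁ x} ≤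
      weakConst n α * ENNReal.ofReal D * (morreyNorm Φ f * ENNReal.ofReal (Φ r)) := by
    refine (mul_volume_discreteG_le hα hα1 hi₁ hc0).trans ?_
    have h1 : ∫⁻ x, ‖f₁ x‖ₑ ≤ morreyNorm Φ f * ENNReal.ofReal (D * Φ r) := by
      simp_rw [hf₁, enorm_indicator_eq_indicator_enorm]
      rw [lintegral_indicator hBm]
      refine (lintegral_ball_le_morreyNorm hΦ.pos f x₀ (by positivity)).trans ?_
      gcongr
      exact hΦ.doubling r hr
    calc _ ≤ weakConst n α * (morreyNorm Φ f * ENNReal.ofReal (D * Φ r)) := by gcongr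
      _ = _ := by rw [ENNReal.ofReal_mul (by linarith [hΦ.one_le])]; ring
  have e2 : ENNReal.ofReal c *
        volume {x | x ∈ Metric.ball x₀ r ∧ ENNReal.ofReal c ^ 2 < discreteG α f₂ x} ≤
      tailConst n D * volume (Metric.closedBall (0 : EuclideanSpace ℝ (Fin n)) 1) *
        (morreyNorm Φ f * ENNReal.ofReal (Φ r)) := by
    -- The bound for the distant part is uniform over the ball. Hence the level set is empty, or `c`
    -- is at most that bound and the volume of the whole ball suffices.
    rcases eq_empty_or_nonempty
      {x | x ∈ Metric.ball x₀ r ∧ ENNReal.ofReal c ^ 2 < discreteG α f₂ x} with h | ⟨x, hxB, hx⟩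
    · rw [h]
      simp
    · have h1 := hx.trans_le (discreteG_indicator_compl_le hα1 hΦ f hxB)
      have h2 := (lt_of_pow_lt_pow_left' 2 h1).le
      have h3 : volume {x | x ∈ Metric.ball x₀ r ∧ ENNReal.ofReal c ^ 2 < discreteG α f₂ x} ≤
          ENNReal.ofReal (r ^ n) *
            volume (Metric.closedBall (0 : EuclideanSpace ℝ (Fin n)) 1) := by
        rw [← volume_closedBall x₀ hr.le]
        exact measure_mono fun y hy => Metric.ball_subset_closedBall hy.1
      have h4 : ENNReal.ofReal ((r ^ n)⁻¹ * Φ r) * ENNReal.ofReal (r ^ n) =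
          ENNReal.ofReal (Φ r) := by
        rw [← ENNReal.ofReal_mul (mul_nonneg (by positivity) (hΦ.pos r hr).le)]
        congr 1
        field_simp
      refine (mul_le_mul' h2 h3).trans (le_of_eq ?_)
      rw [← h4]
      ring
  calc _ ≤ ENNReal.ofReal s * (volume {x | ENNReal.ofReal c ^ 2 < discreteG α f₁ x} +
        volume {x | x ∈ Metric.ball x₀ r ∧ ENNReal.ofReal c ^ 2 < discreteG α f₂ x}) := by
        gcongr
        exact (measure_mono hsub).trans (measure_union_le _ _)
    _ = 2 ^ (n + 2) * (ENNReal.ofReal c * volume {x | ENNReal.ofReal c ^ 2 < discreteG α f₁ x} +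
        ENNReal.ofReal c *
          volume {x | x ∈ Metric.ball x₀ r ∧ ENNReal.ofReal c ^ 2 < discreteG α f₂ x}) := by
        rw [hcs]; ring
    _ ≤ _ := (mul_le_mul_right (add_le_add e1 e2) _).trans
        (le_of_eq (by rw [morreyConst]; ring))

lemma weakMorreyNorm_intrinsicG_le [Nontrivial (EuclideanSpace ℝ (Fin n))] (hα : 0 < α)
    (hα1 : α ≤ 1) {Φ : ℝ → ℝ} {D : ℝ} (hΦ : IsGrowthFunction Φ D)
    {f : EuclideanSpace ℝ (Fin n) → 𝕜} (hf : LocallyIntegrable f) :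
    weakMorreyNorm Φ (intrinsicG α f) ≤ morreyConst n α D * morreyNorm Φ f :=
  sInf_le fun x₀ _ hr => iSup₂_le fun _ hs => mul_volume_intrinsicG_le hα hα1 hΦ hf x₀ hr hs

/-- On each ball the set where the function is infinite lies in every level set, so its volume times
any natural number stays below a fixed finite bound. -/
lemma ae_intrinsicG_lt_top [Nontrivial (EuclideanSpace ℝ (Fin n))] (hα : 0 < α)
    (hα1 : α ≤ 1) {Φ : ℝ → ℝ} {D : ℝ} (hΦ : IsGrowthFunction Φ D) (hD : D < 2 ^ n)
    {f : EuclideanSpace ℝ (Fin n) → 𝕜} (hf : MemMorrey Φ f) :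
    ∀ᵐ x, intrinsicG α f x < ∞ := by
  have hball : ∀ N : ℕ, volume {x | x ∈ Metric.ball (0 : EuclideanSpace ℝ (Fin n)) (N + 1) ∧
      intrinsicG α f x = ∞} = 0 := by
    intro N
    set M := morreyConst n α D * morreyNorm Φ f * ENNReal.ofReal (Φ (N + 1)) with hM
    have hMt : M ≠ ∞ := ENNReal.mul_ne_top
      (ENNReal.mul_ne_top (morreyConst_ne_top hα hD) hf.norm_lt_top.ne) ENNReal.ofReal_ne_top
    by_contra hne
    set v := volume {x | x ∈ Metric.ball (0 : EuclideanSpace ℝ (Fin n)) (N + 1) ∧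
      intrinsicG α f x = ∞} with hv
    have hle : ∀ s : ℕ, (s : ℝ≥0∞) * v ≤ M := by
      intro s
      rcases Nat.eq_zero_or_pos s with rfl | hs
      · simp
      refine le_trans ?_ (mul_volume_intrinsicG_le hα hα1 hΦ hf.locallyIntegrable 0
        (r := (N : ℝ) + 1) (s := s) (by positivity) (by exact_mod_cast hs))
      rw [ENNReal.ofReal_natCast]
      refine mul_le_mul_right (measure_mono ?_) _
      rintro x ⟨hx, hx'⟩
      refine ⟨hx, ?_⟩
      rw [hx']
      exact ENNReal.natCast_lt_top s
    obtain ⟨s, hs⟩ := ENNReal.exists_nat_mul_gt hne hMt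
    exact absurd (hle s) (not_le.2 hs)
  rw [ae_iff]
  refine measure_mono_null (fun x hx => ?_) (measure_iUnion_null hball)
  obtain ⟨N, hN⟩ := exists_nat_gt ‖x‖
  refine mem_iUnion.2 ⟨N, ?_, by simpa using hx⟩
  rw [mem_ball_zero_iff]
  linarith

/-! ### Measurability of `g_α` -/

lemma IsKernel.isBump_one {φ : EuclideanSpace ℝ (Fin n) → 𝕜} (hφ : IsKernel α φ) :
    IsBump α 0 1 φ where
  eq_zero z hz := by
    by_contra hne
    exact hz (hφ.support_subset (Function.mem_support.2 hne))
  integral_eq_zero := hφ.integral_eq_zero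
  holder z z' := by simpa using hφ.holder z z'

open Filter Topology in
-- Dominated convergence: for parameters near `p₀` the dilated kernels are uniformly bounded and
-- live in one fixed ball, on which `f` is integrable.
lemma IsKernel.continuousAt_integral [Nontrivial (EuclideanSpace ℝ (Fin n))] (hα : 0 < α)
    (hα1 : α ≤ 1) {φ : EuclideanSpace ℝ (Fin n) → 𝕜} (hφ : IsKernel α φ)
    {f : EuclideanSpace ℝ (Fin n) → 𝕜} (hf : LocallyIntegrable f)
    {p₀ : EuclideanSpace ℝ (Fin n) × ℝ} (hp₀ : 0 < p₀.2) :
    ContinuousAt (fun p : EuclideanSpace ℝ (Fin n) × ℝ =>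
      ∫ z, dilate p.2 φ (p.1 - z) * f z) p₀ := by
  obtain ⟨y, t⟩ := p₀
  dsimp only at hp₀
  set c : ℝ := 2 ^ (n + 1) with hc
  have hc0 : 0 < c := by positivity
  have hφc : Continuous φ := hφ.isBump_one.continuous hα
  have hev : ∀ᶠ p : EuclideanSpace ℝ (Fin n) × ℝ in 𝓝 (y, t),
      dist p.1 y < 1 ∧ t / 2 < p.2 ∧ p.2 < 2 * t := by
    have h1 : ∀ᶠ p : EuclideanSpace ℝ (Fin n) × ℝ in 𝓝 (y, t), dist p.1 y < 1 :=
      by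
      have h0 : ∀ᶠ p : EuclideanSpace ℝ (Fin n) × ℝ in 𝓝 (y, t), p.1 ∈ Metric.ball y 1 :=
        continuous_fst.continuousAt.eventually_mem (Metric.ball_mem_nhds y one_pos)
      exact h0
    have h2 : ∀ᶠ p : EuclideanSpace ℝ (Fin n) × ℝ in 𝓝 (y, t), p.2 ∈ Ioo (t / 2) (2 * t) :=
      continuous_snd.continuousAt.eventually_mem (Ioo_mem_nhds (by simp; linarith) (by simp; linarith))
    exact h1.and h2
  have hbump : ∀ p : EuclideanSpace ℝ (Fin n) × ℝ, 0 < p.2 →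
      IsBump α p.1 p.2 fun z => c⁻¹ • dilate p.2 φ (p.1 - z) := fun p hp =>
    hφ.isBump hα hα1 p.1 hp le_rfl (by linarith)
  have hmain : ContinuousAt (fun p : EuclideanSpace ℝ (Fin n) × ℝ =>
      ∫ z, (c⁻¹ • dilate p.2 φ (p.1 - z)) * f z) (y, t) := by
    refine continuousAt_of_dominated
      (bound := (Metric.closedBall y (1 + 2 * t)).indicator
        fun z => 3 * ((t / 2) ^ n)⁻¹ * ‖f z‖) ?_ ?_ ?_ ?_
    · filter_upwards [hev] with p hp
      exact ((hbump p (by linarith [hp.2.1])).integrable_mul hα hf).1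
    · filter_upwards [hev] with p ⟨hp1, hp2, hp3⟩
      have hp : 0 < p.2 := by linarith
      refine Filter.Eventually.of_forall fun z => ?_
      by_cases hz : z ∈ Metric.closedBall p.1 p.2
      · have hz' : z ∈ Metric.closedBall y (1 + 2 * t) := by
          rw [Metric.mem_closedBall] at hz ⊢
          linarith [dist_triangle z p.1 y]
        rw [indicator_of_mem hz', norm_mul]
        have h1 := (hbump p hp).norm_le hα1 hp z
        have h2 : (p.2 ^ n)⁻¹ ≤ ((t / 2) ^ n)⁻¹ :=
          inv_anti₀ (by positivity) (pow_le_pow_left₀ (by positivity) hp2.le n)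
        exact mul_le_mul_of_nonneg_right (h1.trans (by linarith)) (norm_nonneg _)
      · rw [(hbump p hp).eq_zero z hz, zero_mul, norm_zero]
        exact indicator_nonneg (fun _ _ => by positivity) z
    · refine IntegrableOn.integrable_indicator ?_ measurableSet_closedBall
      exact (hf.integrableOn_isCompact (isCompact_closedBall y (1 + 2 * t))).norm.const_mul _
    · refine Filter.Eventually.of_forall fun z => ?_
      refine ContinuousAt.mul (ContinuousAt.const_smul ?_ _) continuousAt_const
      unfold dilate
      have h1 : ContinuousAt (fun p : EuclideanSpace ℝ (Fin n) × ℝ => (p.2 ^ n)⁻¹) (y, t) :=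
        ContinuousAt.inv₀ (by fun_prop) (pow_ne_zero n hp₀.ne')
      have h2 : ContinuousAt (fun p : EuclideanSpace ℝ (Fin n) × ℝ => p.2⁻¹ • (p.1 - z)) (y, t) :=
        (continuousAt_snd.inv₀ hp₀.ne').smul (continuousAt_fst.sub continuousAt_const)
      exact h1.smul (hφc.continuousAt.comp h2)
  have hscale : (fun p : EuclideanSpace ℝ (Fin n) × ℝ => ∫ z, dilate p.2 φ (p.1 - z) * f z) =
      fun p => c • ∫ z, (c⁻¹ • dilate p.2 φ (p.1 - z)) * f z := by
    funext p
    simp_rw [smul_mul_assoc]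
    rw [integral_smul, smul_inv_smul₀ hc0.ne']
  rw [hscale]
  exact hmain.const_smul c

lemma measurable_intrinsicG [Nontrivial (EuclideanSpace ℝ (Fin n))] (hα : 0 < α)
    (hα1 : α ≤ 1) {f : EuclideanSpace ℝ (Fin n) → 𝕜} (hf : LocallyIntegrable f) :
    Measurable (intrinsicG α f) := by
  -- A supremum of continuous functions is lower semicontinuous, which handles the uncountable
  -- family of kernels. Extension by zero to `t ≤ 0` preserves this, since `{t > 0}` is open and the
  -- values are nonnegative.
  set H : EuclideanSpace ℝ (Fin n) × ℝ → ℝ≥0∞ :=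
    {p | 0 < p.2}.indicator fun p => intrinsicA α f p.1 p.2 with hH
  have hlsc : LowerSemicontinuous H := by
    intro p a ha
    have hp : 0 < p.2 := by
      by_contra hp
      rw [hH, indicator_of_notMem (show p ∉ {p : EuclideanSpace ℝ (Fin n) × ℝ | 0 < p.2} from hp)]
        at ha
      exact not_lt_zero ha
    rw [hH, indicator_of_mem (show p ∈ {p : EuclideanSpace ℝ (Fin n) × ℝ | 0 < p.2} from hp),
      intrinsicA] at ha
    simp only [lt_iSup_iff] at ha
    obtain ⟨φ, hφ, ha⟩ := ha
    filter_upwards [(hφ.continuousAt_integral hα hα1 hf hp).enorm.eventually (lt_mem_nhds ha),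
      continuous_snd.continuousAt.eventually (lt_mem_nhds hp)] with q hq hq0
    rw [hH, indicator_of_mem (show q ∈ {p : EuclideanSpace ℝ (Fin n) × ℝ | 0 < p.2} from hq0)]
    exact hq.trans_le (le_iSup₂ (f := fun φ (_ : IsKernel α φ) =>
      ‖∫ z, dilate q.2 φ (q.1 - z) * f z‖ₑ) φ hφ)
  have hHm : Measurable fun p : EuclideanSpace ℝ (Fin n) × ℝ =>
      H p ^ 2 / ENNReal.ofReal p.2 :=
    (hlsc.measurable.pow_const 2).div (ENNReal.measurable_ofReal.comp measurable_snd)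
  have heq : intrinsicG α f = fun x =>
      (∫⁻ t in Ioi (0 : ℝ), H (x, t) ^ 2 / ENNReal.ofReal t) ^ (1 / 2 : ℝ) := by
    funext x
    rw [intrinsicG]
    congr 1
    refine setLIntegral_congr_fun measurableSet_Ioi fun t ht => ?_
    simp only [hH]
    rw [indicator_of_mem (show (x, t) ∈ {p : EuclideanSpace ℝ (Fin n) × ℝ | 0 < p.2} from ht)]
  rw [heq]
  exact (Measurable.lintegral_prod_right' hHm).pow_const _

end IntrinsicSquare

end

theorem corollary1p8 {n : ℕ} {𝕜 : Type*} [RCLike 𝕜] (α : ℝ) (hα : 0 < α) (hα1 : α ≤ 1)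
    (Φ : ℝ → ℝ) (D : ℝ) (hΦ : IntrinsicSquare.IsGrowthFunction Φ D) (hD : D < 2 ^ n) :
    ∃ C : ℝ≥0, 0 < C ∧ ∀ f : EuclideanSpace ℝ (Fin n) → 𝕜,
      IntrinsicSquare.MemMorrey Φ f →
        IntrinsicSquare.MemWeakMorrey Φ (IntrinsicSquare.intrinsicG α f) ∧
        IntrinsicSquare.weakMorreyNorm Φ (IntrinsicSquare.intrinsicG α f) ≤
          C * IntrinsicSquare.morreyNorm Φ f := by
  -- In dimension zero the conditions `1 ≤ D` and `D < 2 ^ n` are incompatible.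
  have hn : n ≠ 0 := by
    rintro rfl
    have := hΦ.one_le
    simp at hD
    linarith
  have : Nonempty (Fin n) := ⟨⟨0, Nat.pos_of_ne_zero hn⟩⟩
  have : Nontrivial (EuclideanSpace ℝ (Fin n)) := inferInstance
  have hK := IntrinsicSquare.morreyConst_ne_top (n := n) hα hD
  -- Adding `1` secures a strictly positive constant.
  refine ⟨(IntrinsicSquare.morreyConst n α D).toNNReal + 1, by positivity, fun f hf => ?_⟩
  have hle : IntrinsicSquare.weakMorreyNorm Φ (IntrinsicSquare.intrinsicG α f) ≤
      ((IntrinsicSquare.morreyConst n α D).toNNReal + 1 : ℝ≥0) *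
        IntrinsicSquare.morreyNorm Φ f := by
    refine (IntrinsicSquare.weakMorreyNorm_intrinsicG_le hα hα1 hΦ hf.locallyIntegrable).trans ?_
    gcongr
    rw [ENNReal.coe_add, ENNReal.coe_toNNReal hK]
    exact le_self_add
  exact ⟨⟨IntrinsicSquare.measurable_intrinsicG hα hα1 hf.locallyIntegrable,
    IntrinsicSquare.ae_intrinsicG_lt_top hα hα1 hΦ hD hf,
    hle.trans_lt (ENNReal.mul_lt_top ENNReal.coe_lt_top hf.norm_lt_top)⟩, hle⟩
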